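/- Let $\alpha>1$, let $0<T_0<\tau_0$ be integers and let $(\sigma_n)_{n\ge1}$ be a sequence of positive integers. Put $\tau_n=\tau_0+\sum_{i=1}^n\sigma_i$ and $\rho_n=\sigma_{n+1}/\tau_n$ for $n\ge0$. Consider the time-dependent balls and bins process with two bins, which starts with $T_0$ balls in the first bin out of $\tau_0$ balls in total, and in which $\sigma_n$ balls are added at time $n\ge 1$: on a probability space, $T_{n+1}=T_n+B_{n+1}$ and $\Theta_n=T_n/\tau_n$ for $n\ge0$, where, conditionally on $\mathcal F_n=\sigma(B_1,\dots,B_n)$, the variable $B_{n+1}$ has the binomial distribution with size $\sigma_{n+1}$ and parameter $$P_n=\frac{\Theta_n^{\alpha}}{\Theta_n^{\alpha}+(1-\Theta_n)^{\alpha}}.$$ Suppose that (S) $(\sigma_n)$ is either bounded or tends to infinity, and (R) $(\rho_n)$ is either bounded or tends to infinity. Then dominance occurs almost surely: $$\mathbb P\Big(\lim_{n\to\infty}\Theta_n \text{ exists and belongs to } \{0,1\}\Big)=1.$$ -/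

import Mathlib

open MeasureTheory Filter Topology

noncomputable section

namespace BallsBins

/-- `τ_n = τ_0 + σ_1 + ⋯ + σ_n`, the total number of balls at time `n`.
The number of balls added at time `n ≥ 1` is `σ n`; the value `σ 0` is never used. -/
def totalBalls (τ₀ : ℕ) (σ : ℕ → ℕ) (n : ℕ) : ℕ :=
  τ₀ + ∑ i ∈ Finset.Icc 1 n, σ i

/-- `ρ_n = σ_{n+1} / τ_n`, for `n ≥ 0`. -/
def growthRatio (τ₀ : ℕ) (σ : ℕ → ℕ) (n : ℕ) : ℝ :=
  (σ (n + 1) : ℝ) / (totalBalls τ₀ σ n : ℝ)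

variable {Ω : Type*}

/-- `T_n`, the number of balls in the first bin at time `n`: it starts from `T_0` and
`T_{n+1} = T_n + B_{n+1}`, where `B n` is the number of balls that the first bin receives
at time `n ≥ 1` (`B 0` is never used). -/
def firstBin (T₀ : ℕ) (B : ℕ → Ω → ℕ) : ℕ → Ω → ℕ
  | 0, _ => T₀
  | n + 1, ω => firstBin T₀ B n ω + B (n + 1) ω

/-- `Θ_n = T_n / τ_n`, the proportion of balls in the first bin at time `n`. -/
def proportion (T₀ τ₀ : ℕ) (σ : ℕ → ℕ) (B : ℕ → Ω → ℕ) (n : ℕ) (ω : Ω) : ℝ :=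
  (firstBin T₀ B n ω : ℝ) / (totalBalls τ₀ σ n : ℝ)

/-- The probability `x ^ α / (x ^ α + (1 - x) ^ α)` that a new ball lands in the first bin when
the proportion of balls in that bin is `x`. -/
def feedback (α x : ℝ) : ℝ :=
  x ^ α / (x ^ α + (1 - x) ^ α)

/-- `F_n`, the sigma-algebra generated by `B_1, …, B_n`. -/
abbrev history (B : ℕ → Ω → ℕ) (n : ℕ) : MeasurableSpace Ω :=
  ⨆ i ∈ Finset.Icc 1 n, MeasurableSpace.comap (B i) ⊤

/-- `P(Bin(N, p) = k)`. -/
def binomialMass (N : ℕ) (p : ℝ) (k : ℕ) : ℝ :=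
  (N.choose k : ℝ) * p ^ k * (1 - p) ^ (N - k)

/-- `B` is the sequence of numbers of balls received by the first bin in the time-dependent balls
and bins process with feedback exponent `α`, `T₀` initial balls in the first bin, `τ₀` initial
balls in total, and `σ n` balls added at time `n`: for every `n ≥ 0`, conditionally on
`B_1, …, B_n`, the variable `B_{n+1}` is binomial of size `σ_{n+1}` and parameter
`P_n = feedback α Θ_n`. -/
structure IsBallsAndBins [MeasurableSpace Ω] (μ : Measure Ω) (α : ℝ) (T₀ τ₀ : ℕ) (σ : ℕ → ℕ)
    (B : ℕ → Ω → ℕ) : Prop where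
  measurable : ∀ n, Measurable (B n)
  condLaw : ∀ n k : ℕ,
    μ[({ω | B (n + 1) ω = k}).indicator (fun _ => (1 : ℝ)) | history B n] =ᵐ[μ]
      fun ω => binomialMass (σ (n + 1)) (feedback α (proportion T₀ τ₀ σ B n ω)) k

/-- Dominance: the event that `Θ_n` converges to `0` or to `1`. -/
def dominance (T₀ τ₀ : ℕ) (σ : ℕ → ℕ) (B : ℕ → Ω → ℕ) : Set Ω :=
  {ω | ∃ l ∈ ({0, 1} : Set ℝ), Tendsto (fun n => proportion T₀ τ₀ σ B n ω) atTop (𝓝 l)}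

end BallsBins

end

/-!
Write `z n = Θ n - 1 / 2`, `τ n` for the total number of balls and `P n` for the feedback
probability. Then `z (n + 1) = d n + ξ n`, where
`d n = z n + (σ (n + 1) / τ (n + 1)) * (P n - Θ n)` is known at time `n` and
`ξ n = (B (n + 1) - σ (n + 1) * P n) / τ (n + 1)` is centred given the past, with conditional
variance `v n * P n * (1 - P n)`, where `v n = σ (n + 1) / τ (n + 1) ^ 2`, and conditional fourth
moment at most `v n ^ 2`. Since `α > 1`, the drift pushes `z` away from `0`.

*Convergence.* The sum of the `v n` is at most `1 / τ 0`, by comparison with the telescoping sum of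
`1 / τ n - 1 / τ (n + 1)`. Hence the martingale `∑ ξ n` is bounded in `L²` and converges almost
surely, while the weights `σ (n + 1) / τ (n + 1)` of the drift have an infinite sum. Pathwise, this
forces `Θ` to converge to a zero of the drift, that is to `0`, `1 / 2` or `1`
(`tendsto_trichotomy`).

*The limit `1 / 2` is excluded.* The natural scale at time `n` is `√V`, where `V = ∑_{k ≥ n} v k`
bounds the variance of all the noise to come.
* If `|z n|` is at least a multiple of `√V`, a one-sided Chebyshev inequality shows that with a
  probability bounded below the noise never brings `z` back to `0`
  (`NoisyRecursion.escape`).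
* From any position, `|z|` reaches such a multiple of `√V` with a probability bounded below, before
  half of `V` is spent: as the drift points outwards, the second moment of `z` grows at least as
  the variance of the noise, which a process confined to a small interval does not allow, and the
  fourth moments control the overshoot (`NoisyRecursion.hit`).

Both bounds are uniform in `n` and in the past, because everything is measured relatively to the
remaining variance `V`. So the conditional probability of `z → 0` given the past stays away from
`1`, and by Lévy's zero-one law the event is null (`NoisyRecursion.ae_not_tendsto_zero`).
-/

namespace BallsBins

/-! ### Central moments of the binomial distribution -/

/-- The expectation of `h` under the binomial distribution of size `N` and parameter `p`. -/
def binomialMean (N : ℕ) (p : ℝ) (h : ℕ → ℝ) : ℝ :=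
  ∑ k ∈ Finset.range (N + 1), binomialMass N p k * h k

lemma binomialMass_succ_succ (N : ℕ) (p : ℝ) (k : ℕ) :
    binomialMass (N + 1) p (k + 1) =
      p * binomialMass N p k + (1 - p) * binomialMass N p (k + 1) := by
  unfold binomialMass
  rw [Nat.choose_succ_succ, Nat.add_sub_add_right]
  push_cast
  rcases lt_or_ge k N with h | h
  · have : N - k = (N - (k + 1)) + 1 := by omega
    rw [this]; ring
  · rw [Nat.choose_eq_zero_of_lt (by omega : N < k + 1)]
    push_cast; ring

lemma binomialMean_succ (N : ℕ) (p : ℝ) (h : ℕ → ℝ) :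
    binomialMean (N + 1) p h =
      binomialMean N p (fun k => p * h (k + 1) + (1 - p) * h k) := by
  have h0 : binomialMass (N + 1) p 0 = (1 - p) * binomialMass N p 0 := by
    simp [binomialMass]; ring
  have hN : binomialMass N p (N + 1) = 0 := by simp [binomialMass]
  unfold binomialMean
  rw [Finset.sum_range_succ', h0]
  simp only [binomialMass_succ_succ, add_mul, mul_add, Finset.sum_add_distrib]
  have h1 : ∑ k ∈ Finset.range (N + 1), (1 - p) * binomialMass N p (k + 1) * h (k + 1) +
      (1 - p) * binomialMass N p 0 * h 0 =
      ∑ k ∈ Finset.range (N + 1), binomialMass N p k * ((1 - p) * h k) := by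
    rw [← Finset.sum_range_succ' (fun k => (1 - p) * binomialMass N p k * h k),
      Finset.sum_range_succ, hN]
    simp only [mul_zero, zero_mul, add_zero]
    exact Finset.sum_congr rfl fun k _ => by ring
  rw [add_assoc, h1]
  congr 1
  exact Finset.sum_congr rfl fun k _ => by ring

lemma binomialMean_one (N : ℕ) (p : ℝ) : binomialMean N p (fun _ => 1) = 1 := by
  induction N with
  | zero => simp [binomialMean, binomialMass]
  | succ N ih => rw [binomialMean_succ]; simpa using ih

lemma binomialMean_add (N : ℕ) (p : ℝ) (h g : ℕ → ℝ) :
    binomialMean N p (fun k => h k + g k) = binomialMean N p h + binomialMean N p g := by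
  simp [binomialMean, mul_add, Finset.sum_add_distrib]

lemma binomialMean_const_mul (N : ℕ) (p c : ℝ) (h : ℕ → ℝ) :
    binomialMean N p (fun k => c * h k) = c * binomialMean N p h := by
  simp only [binomialMean, Finset.mul_sum]
  exact Finset.sum_congr rfl fun k _ => by ring

lemma binomialMean_centered (N : ℕ) (p : ℝ) :
    binomialMean N p (fun k => (k : ℝ) - N * p) = 0 := by
  induction N with
  | zero => simp [binomialMean, binomialMass]
  | succ N ih => rw [binomialMean_succ, ← ih]; congr 1; ext k; push_cast; ring

lemma binomialMean_centered_sq (N : ℕ) (p : ℝ) :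
    binomialMean N p (fun k => ((k : ℝ) - N * p) ^ 2) = N * (p * (1 - p)) := by
  induction N with
  | zero => simp [binomialMean, binomialMass]
  | succ N ih =>
    rw [binomialMean_succ]
    have : (fun k : ℕ => p * (((k + 1 : ℕ) : ℝ) - (N + 1 : ℕ) * p) ^ 2 +
        (1 - p) * ((k : ℝ) - (N + 1 : ℕ) * p) ^ 2) =
        fun k : ℕ => ((k : ℝ) - N * p) ^ 2 + (p * (1 - p)) * 1 := by
      ext k; push_cast; ring
    rw [this, binomialMean_add, binomialMean_const_mul, binomialMean_one, ih]
    push_cast; ring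

/-- Adding one trial adds an independent centred term, so the fourth moment increases by
`6 * variance * pq` plus the fourth moment of that term. -/
lemma binomialMean_centered_pow_four (N : ℕ) (p : ℝ) :
    binomialMean N p (fun k => ((k : ℝ) - N * p) ^ 4) =
      N * (p * (1 - p)) * (1 - 3 * (p * (1 - p))) + 3 * N * (N - 1) * (p * (1 - p)) ^ 2 := by
  induction N with
  | zero => simp [binomialMean, binomialMass]
  | succ N ih =>
    rw [binomialMean_succ]
    have : (fun k : ℕ => p * (((k + 1 : ℕ) : ℝ) - (N + 1 : ℕ) * p) ^ 4 +
        (1 - p) * ((k : ℝ) - (N + 1 : ℕ) * p) ^ 4) =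
        fun k : ℕ => (((k : ℝ) - N * p) ^ 4 + (6 * (p * (1 - p))) * ((k : ℝ) - N * p) ^ 2) +
          ((4 * (p * (1 - p)) * (1 - 2 * p)) * ((k : ℝ) - N * p) +
            (p * (1 - p) * (1 - 3 * (p * (1 - p)))) * 1) := by
      ext k; push_cast; ring
    rw [this, binomialMean_add, binomialMean_add, binomialMean_add, binomialMean_const_mul,
      binomialMean_const_mul, binomialMean_const_mul, binomialMean_one, ih,
      binomialMean_centered_sq, binomialMean_centered]
    push_cast; ring

lemma binomialMean_centered_pow_four_le (N : ℕ) {p : ℝ} (h0 : 0 ≤ p) (h1 : p ≤ 1) :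
    binomialMean N p (fun k => ((k : ℝ) - N * p) ^ 4) ≤ (N : ℝ) ^ 2 := by
  rw [binomialMean_centered_pow_four]
  have hp : 0 ≤ p * (1 - p) := mul_nonneg h0 (by linarith)
  have hp' : p * (1 - p) ≤ 1 / 4 := by nlinarith [sq_nonneg (p - 1 / 2)]
  generalize p * (1 - p) = x at *
  have hx : x ^ 2 ≤ 1 / 16 := by nlinarith
  rcases Nat.eq_zero_or_pos N with rfl | hN
  · simp
  have hN1 : (1 : ℝ) ≤ N := by exact_mod_cast hN
  have e1 : (N : ℝ) * x * (1 - 3 * x) ≤ N ^ 2 * (1 / 4) := by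
    have : x * (1 - 3 * x) ≤ 1 / 4 := by nlinarith
    have h2 : (N : ℝ) * (x * (1 - 3 * x)) ≤ N * (1 / 4) := by gcongr
    nlinarith
  have e2 : 3 * (N : ℝ) * (N - 1) * x ^ 2 ≤ 3 * N * N * (1 / 16) := by
    have : 3 * (N : ℝ) * (N - 1) * x ^ 2 ≤ 3 * (N : ℝ) * (N - 1) * (1 / 16) := by
      have : 0 ≤ 3 * (N : ℝ) * (N - 1) := by
        have : 0 ≤ (N : ℝ) - 1 := by linarith
        positivity
      gcongr
    nlinarith
  nlinarith

/-! ### The feedback function -/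

section Feedback

variable {α x : ℝ}

lemma feedback_den_pos (h0 : 0 ≤ x) (h1 : x ≤ 1) :
    0 < x ^ α + (1 - x) ^ α := by
  rcases h0.eq_or_lt with rfl | h
  · have : (0 : ℝ) ≤ 0 ^ α := Real.rpow_nonneg le_rfl α
    simp; positivity
  · have := Real.rpow_pos_of_pos h α
    have := Real.rpow_nonneg (sub_nonneg.2 h1) α
    positivity

lemma feedback_nonneg (h0 : 0 ≤ x) (h1 : x ≤ 1) : 0 ≤ feedback α x :=
  div_nonneg (Real.rpow_nonneg h0 α) (feedback_den_pos h0 h1).le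

lemma feedback_le_one (h0 : 0 ≤ x) (h1 : x ≤ 1) : feedback α x ≤ 1 := by
  unfold feedback
  rw [div_le_one (feedback_den_pos h0 h1)]
  linarith [Real.rpow_nonneg (sub_nonneg.2 h1) α]

lemma feedback_one_sub (h0 : 0 ≤ x) (h1 : x ≤ 1) : feedback α (1 - x) = 1 - feedback α x := by
  have h := (feedback_den_pos (α := α) h0 h1).ne'
  unfold feedback
  rw [sub_sub_cancel, add_comm ((1 - x) ^ α)]
  field_simp
  ring

lemma feedback_half : feedback α (1 / 2) = 1 / 2 := by
  have := feedback_one_sub (α := α) (x := 1 / 2) (by norm_num) (by norm_num)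
  norm_num at this ⊢
  linarith

lemma lt_feedback (hα : 1 < α) (h0 : 1 / 2 < x) (h1 : x < 1) : x < feedback α x := by
  have hx : 0 < x := by linarith
  have hy : 0 < 1 - x := by linarith
  unfold feedback
  rw [lt_div_iff₀ (feedback_den_pos hx.le h1.le)]
  have e : (1 - x) ^ (α - 1) < x ^ (α - 1) :=
    Real.rpow_lt_rpow hy.le (by linarith) (by linarith)
  have ex : x ^ α = x ^ (α - 1) * x := by
    rw [← Real.rpow_add_one hx.ne']; ring_nf
  have ey : (1 - x) ^ α = (1 - x) ^ (α - 1) * (1 - x) := by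
    rw [← Real.rpow_add_one hy.ne']; ring_nf
  have := mul_lt_mul_of_pos_right e (mul_pos hx hy)
  rw [ex, ey]
  nlinarith

lemma le_feedback (hα : 1 < α) (h0 : 1 / 2 ≤ x) (h1 : x ≤ 1) : x ≤ feedback α x := by
  rcases h0.eq_or_lt with rfl | h
  · exact feedback_half.ge
  rcases h1.eq_or_lt with rfl | h'
  · simp [feedback, Real.zero_rpow (by linarith : α ≠ 0)]
  exact (lt_feedback hα h h').le

lemma feedback_le (hα : 1 < α) (h0 : 0 ≤ x) (h1 : x ≤ 1 / 2) : feedback α x ≤ x := by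
  have := le_feedback hα (x := 1 - x) (by linarith) (by linarith)
  rw [feedback_one_sub h0 (by linarith)] at this
  linarith

lemma measurable_feedback : Measurable (feedback α) := by
  unfold feedback; fun_prop

lemma continuousAt_feedback (hα : 1 < α) (h0 : 0 ≤ x) (h1 : x ≤ 1) :
    ContinuousAt (feedback α) x := by
  unfold feedback
  have hα' : 0 ≤ α := by linarith
  refine ContinuousAt.div ?_ ?_ (feedback_den_pos h0 h1).ne'
  · exact continuousAt_id.rpow_const (Or.inr hα')
  · exact (continuousAt_id.rpow_const (Or.inr hα')).add
      ((continuousAt_const.sub continuousAt_id).rpow_const (Or.inr hα'))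

/-- Differentiability gives the bound near `1 / 2`, and boundedness elsewhere. -/
lemma exists_feedback_lipschitz (α : ℝ) :
    ∃ L : ℝ, 1 ≤ L ∧ ∀ x, 0 ≤ x → x ≤ 1 → |feedback α x - 1 / 2| ≤ L * |x - 1 / 2| := by
  have hd : DifferentiableAt ℝ (feedback α) (1 / 2) := by
    unfold feedback
    refine DifferentiableAt.div ?_ ?_
      (feedback_den_pos (α := α) (x := 1 / 2) (by norm_num) (by norm_num)).ne'
    · exact differentiableAt_id.rpow_const (Or.inl (by norm_num))
    · exact (differentiableAt_id.rpow_const (Or.inl (by norm_num))).add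
        (((differentiableAt_const _).sub differentiableAt_id).rpow_const (Or.inl (by norm_num)))
  obtain ⟨C, hC⟩ := hd.isBigO_sub.bound
  obtain ⟨δ, hδ, hC⟩ := Metric.eventually_nhds_iff.1 hC
  refine ⟨max 1 (max C (1 / δ)), le_max_left _ _, fun x h0 h1 => ?_⟩
  by_cases hx : |x - 1 / 2| < δ
  · have := hC (y := x) (by rwa [Real.dist_eq])
    rw [feedback_half, Real.norm_eq_abs, Real.norm_eq_abs] at this
    refine this.trans ?_
    gcongr
    exact (le_max_left _ _).trans (le_max_right _ _)
  · push Not at hx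
    have e1 : |feedback α x - 1 / 2| ≤ 1 := by
      rw [abs_le]
      constructor <;> linarith [feedback_nonneg (α := α) h0 h1, feedback_le_one (α := α) h0 h1]
    refine e1.trans ?_
    calc (1 : ℝ) = 1 / δ * δ := by field_simp
      _ ≤ max 1 (max C (1 / δ)) * |x - 1 / 2| := by
        gcongr
        exact (le_max_right _ _).trans (le_max_right _ _)

lemma exists_feedback_variance (hα : 1 < α) :
    ∃ δ : ℝ, 0 < δ ∧ ∀ x, |x - 1 / 2| < δ → 1 / 8 ≤ feedback α x * (1 - feedback α x) := by
  have hc := continuousAt_feedback hα (x := 1 / 2) (by norm_num) (by norm_num)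
  have hc2 : ContinuousAt (fun x => feedback α x * (1 - feedback α x)) (1 / 2) :=
    hc.mul (continuousAt_const.sub hc)
  have : ∀ᶠ x in 𝓝 (1 / 2 : ℝ), 1 / 8 < feedback α x * (1 - feedback α x) :=
    hc2.eventually (lt_mem_nhds (by simp only [feedback_half]; norm_num))
  obtain ⟨δ, hδ, h⟩ := Metric.eventually_nhds_iff.1 this
  exact ⟨δ, hδ, fun x hx => (h (by rwa [Real.dist_eq])).le⟩

end Feedback

/-! ### A perturbed recursion repelled by the origin -/

/-- A bounded sequence that follows the drift `γ k * h (z k)` up to a perturbation `ξ k` with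
convergent (not necessarily absolutely) series, with
`h` positive on `(0, a)`, converges to `a` as soon as it is infinitely often far above `0`:
once the tails of `∑ ξ k` are small, the drift keeps it away from `0`, hence `z k - ∑_{j<k} ξ j`
is eventually monotone, and the divergence of `∑ γ k` rules out a limit in `(0, a)`. -/
lemma tendsto_of_frequently_ge {z ξ γ : ℕ → ℝ} {h : ℝ → ℝ} {a s δ : ℝ}
    (hz : ∀ k, z k ≤ a) (hrec : ∀ k, z (k + 1) = z k + γ k * h (z k) + ξ k)
    (hγ : ∀ k, 0 ≤ γ k) (hγs : ¬ Summable γ)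
    (hh : ∀ x, 0 < x → x ≤ a → 0 ≤ h x) (hh' : ∀ x, 0 < x → x < a → 0 < h x)
    (hc : ∀ x, 0 < x → x < a → ContinuousAt h x)
    (hξ : Tendsto (fun n => ∑ k ∈ Finset.range n, ξ k) atTop (𝓝 s))
    (hδ : 0 < δ) (hf : ∃ᶠ k in atTop, 2 * δ ≤ z k) : Tendsto z atTop (𝓝 a) := by
  set S : ℕ → ℝ := fun n => ∑ k ∈ Finset.range n, ξ k with hS
  have hS1 : ∀ k, S (k + 1) = S k + ξ k := fun k => Finset.sum_range_succ _ _
  obtain ⟨N, hN⟩ := Metric.cauchySeq_iff.1 hξ.cauchySeq δ hδ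
  obtain ⟨n, hnN, hn⟩ := frequently_atTop.1 hf N
  have key : ∀ j, δ ≤ z (n + j) ∧ z n - S n ≤ z (n + j) - S (n + j) := by
    intro j
    induction j with
    | zero => exact ⟨by simp; linarith, le_rfl⟩
    | succ j ih =>
      have h1 := hh _ (hδ.trans_le ih.1) (hz _)
      have h2 := mul_nonneg (hγ (n + j)) h1
      have h3 := hrec (n + j)
      have h4 := hS1 (n + j)
      have h5 := hN (n + j + 1) (by omega) n hnN
      rw [Real.dist_eq, abs_lt] at h5
      rw [← add_assoc]
      have h6 : z n - S n ≤ z (n + j + 1) - S (n + j + 1) := by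
        linarith [ih.2]
      exact ⟨by linarith [h5.1], h6⟩
  set y : ℕ → ℝ := fun j => z (n + j) - S (n + j) with hy
  have hstep : ∀ j, y (j + 1) = y j + γ (n + j) * h (z (n + j)) := by
    intro j
    have h3 := hrec (n + j)
    have h4 := hS1 (n + j)
    simp only [hy, ← add_assoc]
    linarith
  have hmono : Monotone y := monotone_nat_of_le_succ fun j => by
    rw [hstep]
    have := mul_nonneg (hγ (n + j)) (hh _ (hδ.trans_le (key j).1) (hz _))
    linarith
  obtain ⟨b, hb⟩ := hξ.bddBelow_range
  have hbdd : BddAbove (Set.range y) := by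
    refine ⟨a - b, ?_⟩
    rintro _ ⟨j, rfl⟩
    have := hb ⟨n + j, rfl⟩
    have := hz (n + j)
    simp only [hy]
    linarith
  have hylim := tendsto_atTop_ciSup hmono hbdd
  set l := ⨆ i, y i
  have hSlim : Tendsto (fun j => S (n + j)) atTop (𝓝 s) := by
    have := (tendsto_add_atTop_iff_nat n).2 hξ
    simpa [add_comm] using this
  have hzlim' : Tendsto (fun j => z (n + j)) atTop (𝓝 (l + s)) := by
    have := hylim.add hSlim
    simpa [hy] using this
  have hzlim : Tendsto z atTop (𝓝 (l + s)) := by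
    rw [← tendsto_add_atTop_iff_nat n]
    simpa [add_comm] using hzlim'
  have hge : δ ≤ l + s := ge_of_tendsto' hzlim' fun j => (key j).1
  have hle : l + s ≤ a := le_of_tendsto' hzlim hz
  rcases hle.eq_or_lt with e | hlt
  · rwa [e] at hzlim
  exfalso
  have hp := hh' _ (hδ.trans_le hge) hlt
  have hev : ∀ᶠ j in atTop, h (l + s) / 2 < h (z (n + j)) :=
    ((hc _ (hδ.trans_le hge) hlt).tendsto.comp hzlim').eventually (lt_mem_nhds (by linarith))
  obtain ⟨J, hJ⟩ := eventually_atTop.1 hev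
  have hbd : ∀ m, ∑ j ∈ Finset.range m, γ (n + J + j) ≤ (l - y J) / (h (l + s) / 2) := by
    intro m
    rw [le_div_iff₀ (by linarith)]
    have : (∑ j ∈ Finset.range m, γ (n + J + j)) * (h (l + s) / 2) ≤ y (J + m) - y J := by
      induction m with
      | zero => simp
      | succ m ih =>
        rw [Finset.sum_range_succ, ← add_assoc, hstep]
        have h1 := mul_le_mul_of_nonneg_left (hJ (J + m) (by omega)).le (hγ (n + (J + m)))
        rw [add_mul, add_assoc n J m]
        linarith
    linarith [le_ciSup hbdd (J + m)]
  have : Summable fun j => γ (n + J + j) := summable_of_sum_range_le (fun _ => hγ _) hbd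
  refine hγs ((summable_nat_add_iff (n + J)).1 ?_)
  simpa [add_comm] using this

/-- For an odd drift `h`, repelled by `0`, `tendsto_of_frequently_ge` applies to `z` or to `-z`
unless both are eventually below every positive level. -/
lemma tendsto_trichotomy {z ξ γ : ℕ → ℝ} {h : ℝ → ℝ} {a s : ℝ}
    (hz : ∀ k, |z k| ≤ a) (hrec : ∀ k, z (k + 1) = z k + γ k * h (z k) + ξ k)
    (hγ : ∀ k, 0 ≤ γ k) (hγs : ¬ Summable γ)
    (hodd : ∀ x, |x| ≤ a → h (-x) = - h x)
    (hh : ∀ x, 0 < x → x ≤ a → 0 ≤ h x) (hh' : ∀ x, 0 < x → x < a → 0 < h x)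
    (hc : ∀ x, 0 < x → x < a → ContinuousAt h x)
    (hξ : Tendsto (fun n => ∑ k ∈ Finset.range n, ξ k) atTop (𝓝 s)) :
    Tendsto z atTop (𝓝 a) ∨ Tendsto z atTop (𝓝 (-a)) ∨ Tendsto z atTop (𝓝 0) := by
  by_cases h1 : ∃ δ > 0, ∃ᶠ k in atTop, 2 * δ ≤ z k
  · obtain ⟨δ, hδ, hf⟩ := h1
    exact Or.inl (tendsto_of_frequently_ge (fun k => (abs_le.1 (hz k)).2) hrec hγ hγs hh hh' hc
      hξ hδ hf)
  by_cases h2 : ∃ δ > 0, ∃ᶠ k in atTop, 2 * δ ≤ - z k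
  · obtain ⟨δ, hδ, hf⟩ := h2
    have := tendsto_of_frequently_ge (z := fun k => - z k) (ξ := fun k => - ξ k) (s := -s)
      (h := h) (γ := γ)
      (fun k => by linarith [(abs_le.1 (hz k)).1])
      (fun k => by rw [hodd _ (hz k), hrec k]; ring) hγ hγs hh hh' hc
      (by simpa using hξ.neg) hδ hf
    refine Or.inr (Or.inl ?_)
    simpa using this.neg
  refine Or.inr (Or.inr ?_)
  rw [Metric.tendsto_atTop']
  intro ε hε
  have e1 : ∀ᶠ k in atTop, z k < 2 * (ε / 2) := by
    by_contra hcon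
    exact h1 ⟨ε / 2, by linarith, fun h => hcon (h.mono fun k hk => not_le.1 hk)⟩
  have e2 : ∀ᶠ k in atTop, - z k < 2 * (ε / 2) := by
    by_contra hcon
    exact h2 ⟨ε / 2, by linarith, fun h => hcon (h.mono fun k hk => not_le.1 hk)⟩
  obtain ⟨N, hN⟩ := eventually_atTop.1 (e1.and e2)
  refine ⟨N, fun k hk => ?_⟩
  have := hN k hk.le
  rw [Real.dist_eq, sub_zero, abs_lt]
  constructor <;> linarith [this.1, this.2]

/-! ### Noisy recursions repelled by the origin -/

section NoisyRecursion

variable {Ω : Type*} {m0 : MeasurableSpace Ω}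

/-- A bounded adapted process `z (k + 1) = d k + ξ k` whose predictable part `d k` has the sign of
`z k` and satisfies `|z k| ≤ |d k| ≤ L * |z k|`, and whose noise `ξ k` is conditionally centred,
with conditional variance at most `v k`, at least `v k / 8` as long as `|z k| < δ`, and conditional
fourth moment at most `v k ^ 2`. Conditional moments are expressed by integrals over the events of
`ℱ k` (for the mean: against bounded `ℱ k`-measurable functions). -/
structure NoisyRecursion (μ : Measure Ω) (ℱ : Filtration ℕ m0) (v : ℕ → ℝ) (L δ : ℝ)
    (z d ξ : ℕ → Ω → ℝ) : Prop where
  step : ∀ k ω, z (k + 1) ω = d k ω + ξ k ω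
  measurable_z : ∀ k, Measurable[ℱ k] (z k)
  measurable_d : ∀ k, Measurable[ℱ k] (d k)
  abs_z_le : ∀ k ω, |z k ω| ≤ 1
  abs_d_le : ∀ k ω, |d k ω| ≤ 1
  sq_le_mul : ∀ k ω, z k ω ^ 2 ≤ z k ω * d k ω
  abs_d_le_mul : ∀ k ω, |d k ω| ≤ L * |z k ω|
  mean : ∀ k (c : Ω → ℝ), Measurable[ℱ k] c → (∃ C, ∀ ω, |c ω| ≤ C) → ∫ ω, c ω * ξ k ω ∂μ = 0
  variance_le : ∀ k A, MeasurableSet[ℱ k] A → ∫ ω in A, ξ k ω ^ 2 ∂μ ≤ v k * μ.real A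
  le_variance : ∀ k A, MeasurableSet[ℱ k] A → (∀ ω ∈ A, |z k ω| < δ) →
    v k / 8 * μ.real A ≤ ∫ ω in A, ξ k ω ^ 2 ∂μ
  fourth_le : ∀ k A, MeasurableSet[ℱ k] A → ∫ ω in A, ξ k ω ^ 4 ∂μ ≤ v k ^ 2 * μ.real A

/-- The filtration `ℱ (n + ·)`. -/
def shiftFiltration (ℱ : Filtration ℕ m0) (n : ℕ) : Filtration ℕ m0 where
  seq k := ℱ (n + k)
  mono' _ _ h := ℱ.mono (by omega)
  le' k := ℱ.le (n + k)

/-- The sum `∑_{k<K} 1_{D k} s ξ_k`: the martingale with increments `s ξ_k`, run only while the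
events `D k` hold (`s` is a sign). -/
noncomputable def restrictedSum (D : ℕ → Set Ω) (s : Ω → ℝ) (ξ : ℕ → Ω → ℝ) (K : ℕ) (ω : Ω) : ℝ :=
  ∑ k ∈ Finset.range K, (D k).indicator s ω * ξ k ω

lemma restrictedSum_succ (D : ℕ → Set Ω) (s : Ω → ℝ) (ξ : ℕ → Ω → ℝ) (K : ℕ) (ω : Ω) :
    restrictedSum D s ξ (K + 1) ω = restrictedSum D s ξ K ω + (D K).indicator s ω * ξ K ω :=
  Finset.sum_range_succ _ _

/-- The event of `A` that `z j ^ 2 < θ` for all `j ≤ k`. -/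
def confined (z : ℕ → Ω → ℝ) (θ : ℝ) (A : Set Ω) (k : ℕ) : Set Ω :=
  {ω | ω ∈ A ∧ ∀ j ≤ k, z j ω ^ 2 < θ}

lemma confined_subset (z : ℕ → Ω → ℝ) (θ : ℝ) (A : Set Ω) (k : ℕ) : confined z θ A k ⊆ A :=
  fun _ h => h.1

lemma confined_succ_subset (z : ℕ → Ω → ℝ) (θ : ℝ) (A : Set Ω) (k : ℕ) :
    confined z θ A (k + 1) ⊆ confined z θ A k :=
  fun _ h => ⟨h.1, fun j hj => h.2 j (hj.trans (Nat.le_succ k))⟩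

lemma integrable_of_measurable_of_abs_le {μ : Measure Ω} [IsFiniteMeasure μ] {f : Ω → ℝ} {C : ℝ}
    (hf : Measurable f) (h : ∀ ω, |f ω| ≤ C) : Integrable f μ :=
  Integrable.of_bound hf.aestronglyMeasurable C (ae_of_all _ h)

namespace NoisyRecursion

variable {μ : Measure Ω} [IsProbabilityMeasure μ] {ℱ : Filtration ℕ m0} {v : ℕ → ℝ} {L δ : ℝ}
  {z d ξ : ℕ → Ω → ℝ}

omit [IsProbabilityMeasure μ] in
lemma shift (R : NoisyRecursion μ ℱ v L δ z d ξ) (n : ℕ) :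
    NoisyRecursion μ (shiftFiltration ℱ n) (fun k => v (n + k)) L δ (fun k => z (n + k))
      (fun k => d (n + k)) (fun k => ξ (n + k)) where
  step k := R.step (n + k)
  measurable_z k := R.measurable_z (n + k)
  measurable_d k := R.measurable_d (n + k)
  abs_z_le k := R.abs_z_le (n + k)
  abs_d_le k := R.abs_d_le (n + k)
  sq_le_mul k := R.sq_le_mul (n + k)
  abs_d_le_mul k := R.abs_d_le_mul (n + k)
  mean k := R.mean (n + k)
  variance_le k := R.variance_le (n + k)
  le_variance k := R.le_variance (n + k)
  fourth_le k := R.fourth_le (n + k)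

section
omit [IsProbabilityMeasure μ]
variable (R : NoisyRecursion μ ℱ v L δ z d ξ)
include R

lemma noise_eq (k : ℕ) (ω : Ω) : ξ k ω = z (k + 1) ω - d k ω := by
  rw [R.step]; ring

lemma measurable_noise (k : ℕ) : Measurable[ℱ (k + 1)] (ξ k) := by
  have : ξ k = fun ω => z (k + 1) ω - d k ω := funext (R.noise_eq k)
  rw [this]
  exact (R.measurable_z (k + 1)).sub ((R.measurable_d k).mono (ℱ.mono (Nat.le_succ k)) le_rfl)

lemma abs_noise_le (k : ℕ) (ω : Ω) : |ξ k ω| ≤ 2 := by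
  rw [R.noise_eq]
  have h1 := abs_le.1 (R.abs_z_le (k + 1) ω)
  have h2 := abs_le.1 (R.abs_d_le k ω)
  rw [abs_le]
  constructor <;> linarith [h1.1, h1.2, h2.1, h2.2]

lemma measurable_restrictedSum {D : ℕ → Set Ω} {s : Ω → ℝ} (hD : ∀ k, MeasurableSet[ℱ k] (D k))
    (hs : Measurable[ℱ 0] s) (K : ℕ) : Measurable[ℱ K] (restrictedSum D s ξ K) := by
  induction K with
  | zero => exact measurable_const
  | succ K ih =>
    have : restrictedSum D s ξ (K + 1) =
        fun ω => restrictedSum D s ξ K ω + (D K).indicator s ω * ξ K ω :=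
      funext (restrictedSum_succ D s ξ K)
    rw [this]
    have hle := ℱ.mono (Nat.le_succ K)
    exact (ih.mono hle le_rfl).add
      (((((hs.mono (ℱ.mono (Nat.zero_le K)) le_rfl).indicator (hD K))).mono hle le_rfl).mul
        (R.measurable_noise K))

lemma abs_indicator_mul_noise_le {D : ℕ → Set Ω} {s : Ω → ℝ} (hs1 : ∀ ω, s ω ^ 2 = 1) (k : ℕ)
    (ω : Ω) : |(D k).indicator s ω * ξ k ω| ≤ 2 := by
  by_cases h : ω ∈ D k
  · have : |s ω| = 1 :=
        (pow_eq_one_iff_of_nonneg (abs_nonneg _) two_ne_zero).1 (by rw [sq_abs, hs1])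
    simpa [h, abs_mul, this] using R.abs_noise_le k ω
  · simp [h]

lemma abs_restrictedSum_le {D : ℕ → Set Ω} {s : Ω → ℝ} (hs1 : ∀ ω, s ω ^ 2 = 1) (K : ℕ) (ω : Ω) :
    |restrictedSum D s ξ K ω| ≤ 2 * K := by
  refine (Finset.abs_sum_le_sum_abs _ _).trans ?_
  refine (Finset.sum_le_sum fun k _ => R.abs_indicator_mul_noise_le hs1 k ω).trans ?_
  simp [mul_comm]

lemma setIntegral_indicator_mul_noise {D : ℕ → Set Ω} {s : Ω → ℝ}
    (hD : ∀ k, MeasurableSet[ℱ k] (D k)) (hs : Measurable[ℱ 0] s) (hs1 : ∀ ω, s ω ^ 2 = 1) (k : ℕ)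
    {A : Set Ω} (hA : MeasurableSet[ℱ k] A) :
    ∫ ω in A, (D k).indicator s ω * ξ k ω ∂μ = 0 := by
  rw [← integral_indicator (ℱ.le k _ hA)]
  rw [← R.mean k (A.indicator ((D k).indicator s))
    (((hs.mono (ℱ.mono (Nat.zero_le k)) le_rfl).indicator (hD k)).indicator hA) ⟨1, fun ω => ?_⟩]
  · congr 1; ext ω
    by_cases h : ω ∈ A <;> simp [h]
  · have : |s ω| = 1 :=
        (pow_eq_one_iff_of_nonneg (abs_nonneg _) two_ne_zero).1 (by rw [sq_abs, hs1])
    by_cases h : ω ∈ A <;> by_cases h' : ω ∈ D k <;> simp [h, h', this]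

end

variable (R : NoisyRecursion μ ℱ v L δ z d ξ)
include R

lemma integrable_sq_z (k : ℕ) : Integrable (fun ω => z k ω ^ 2) μ :=
  integrable_of_measurable_of_abs_le (C := 1)
    (((R.measurable_z k).mono (ℱ.le k) le_rfl).pow_const 2) fun ω => by
      rw [abs_pow]; exact pow_le_one₀ (abs_nonneg _) (R.abs_z_le k ω)

lemma integrable_noise_pow (k j : ℕ) : Integrable (fun ω => ξ k ω ^ j) μ :=
  integrable_of_measurable_of_abs_le (C := 2 ^ j)
    (((R.measurable_noise k).mono (ℱ.le _) le_rfl).pow_const j) fun ω => by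
      rw [abs_pow]; gcongr; exact R.abs_noise_le k ω

lemma integrable_restrictedSum_pow {D : ℕ → Set Ω} {s : Ω → ℝ}
    (hD : ∀ k, MeasurableSet[ℱ k] (D k))
    (hs : Measurable[ℱ 0] s) (hs1 : ∀ ω, s ω ^ 2 = 1) (K j : ℕ) :
    Integrable (fun ω => restrictedSum D s ξ K ω ^ j) μ :=
  integrable_of_measurable_of_abs_le (C := (2 * K) ^ j)
    (((R.measurable_restrictedSum hD hs K).mono (ℱ.le _) le_rfl).pow_const j) fun ω => by
      rw [abs_pow]; gcongr; exact R.abs_restrictedSum_le hs1 K ω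

lemma setIntegral_restrictedSum {D : ℕ → Set Ω} {s : Ω → ℝ}
    (hD : ∀ k, MeasurableSet[ℱ k] (D k)) (hs : Measurable[ℱ 0] s) (hs1 : ∀ ω, s ω ^ 2 = 1)
    {A : Set Ω} (hA : MeasurableSet[ℱ 0] A) (K : ℕ) :
    ∫ ω in A, restrictedSum D s ξ K ω ∂μ = 0 := by
  unfold restrictedSum
  rw [integral_finsetSum]
  · exact Finset.sum_eq_zero fun k _ =>
      R.setIntegral_indicator_mul_noise hD hs hs1 k (ℱ.mono (Nat.zero_le k) _ hA)
  · intro k _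
    refine (integrable_of_measurable_of_abs_le (C := 2) ?_
      fun ω => R.abs_indicator_mul_noise_le hs1 k ω).integrableOn
    exact ((hs.mono (ℱ.le 0) le_rfl).indicator (ℱ.le k _ (hD k))).mul
      ((R.measurable_noise k).mono (ℱ.le _) le_rfl)

/-- Orthogonality of the increments bounds the second moment of the restricted martingale. -/
lemma setIntegral_sq_restrictedSum_le {D : ℕ → Set Ω} {s : Ω → ℝ} (hv : ∀ k, 0 ≤ v k)
    (hD : ∀ k, MeasurableSet[ℱ k] (D k)) (hs : Measurable[ℱ 0] s) (hs1 : ∀ ω, s ω ^ 2 = 1)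
    {A : Set Ω} (hA : MeasurableSet[ℱ 0] A) (K : ℕ) :
    ∫ ω in A, restrictedSum D s ξ K ω ^ 2 ∂μ ≤ (∑ k ∈ Finset.range K, v k) * μ.real A := by
  induction K with
  | zero => simp [restrictedSum]
  | succ K ih =>
    have hAK : MeasurableSet[ℱ K] A := ℱ.mono (Nat.zero_le K) _ hA
    have hA0 := ℱ.le 0 _ hA
    set c : Ω → ℝ :=
      A.indicator fun ω => 2 * restrictedSum D s ξ K ω * (D K).indicator s ω with hc
    have hcm : Measurable[ℱ K] c :=
      (((R.measurable_restrictedSum hD hs K).const_mul 2).mul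
        ((hs.mono (ℱ.mono (Nat.zero_le K)) le_rfl).indicator (hD K))).indicator hAK
    have hcb : ∀ ω, |c ω| ≤ 4 * K := fun ω => by
      have h1 : |s ω| = 1 :=
        (pow_eq_one_iff_of_nonneg (abs_nonneg _) two_ne_zero).1 (by rw [sq_abs, hs1])
      have h2 := R.abs_restrictedSum_le (D := D) hs1 K ω
      by_cases h : ω ∈ A
      · by_cases h' : ω ∈ D K
        · simp only [hc, h, h', Set.indicator_of_mem, abs_mul, h1, abs_two]; linarith
        · simp [hc, h, h']
      · simp [hc, h]
    have hmean := R.mean K c hcm ⟨_, hcb⟩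
    have hcint : Integrable (fun ω => c ω * ξ K ω) μ :=
      integrable_of_measurable_of_abs_le (C := 4 * K * 2)
        ((hcm.mono (ℱ.le _) le_rfl).mul ((R.measurable_noise K).mono (ℱ.le _) le_rfl))
        fun ω => by
          rw [abs_mul]
          exact mul_le_mul (hcb ω) (R.abs_noise_le K ω) (abs_nonneg _) (by positivity)
    have hpt : ∀ ω ∈ A, restrictedSum D s ξ (K + 1) ω ^ 2 =
        restrictedSum D s ξ K ω ^ 2 + c ω * ξ K ω + (D K).indicator (fun ω => ξ K ω ^ 2) ω := by
      intro ω hω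
      rw [restrictedSum_succ]
      by_cases h' : ω ∈ D K
      · simp only [hc, hω, h', Set.indicator_of_mem]
        linear_combination (ξ K ω ^ 2) * hs1 ω
      · simp [hc, hω, h']
    have hDK := ℱ.le K _ (hD K)
    have hx2 := (R.integrable_noise_pow K 2).indicator hDK
    rw [setIntegral_congr_fun hA0 hpt, integral_add, integral_add]
    · have e1 : ∫ ω in A, c ω * ξ K ω ∂μ = 0 := by
        rw [← hmean, ← integral_indicator hA0]
        congr 1; ext ω
        by_cases h : ω ∈ A <;> simp [hc, h]
      have e2 : ∫ ω in A, (D K).indicator (fun ω => ξ K ω ^ 2) ω ∂μ ≤ v K * μ.real A := by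
        rw [setIntegral_indicator hDK]
        refine (R.variance_le K _ (MeasurableSet.inter hAK (hD K))).trans ?_
        exact mul_le_mul_of_nonneg_left (measureReal_mono Set.inter_subset_left) (hv K)
      rw [Finset.sum_range_succ, add_mul]
      linarith
    · exact (R.integrable_restrictedSum_pow hD hs hs1 K 2).integrableOn
    · exact hcint.integrableOn
    · exact ((R.integrable_restrictedSum_pow hD hs hs1 K 2).integrableOn).add hcint.integrableOn
    · exact hx2.integrableOn

/-- The series of the noise converges almost surely, as a martingale bounded in `L²`. -/
lemma ae_exists_tendsto_sum_noise {V : ℝ} (hv : ∀ k, 0 ≤ v k)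
    (hV : ∀ K, ∑ k ∈ Finset.range K, v k ≤ V) :
    ∀ᵐ ω ∂μ, ∃ s, Tendsto (fun n => ∑ k ∈ Finset.range n, ξ k ω) atTop (𝓝 s) := by
  have hD : ∀ k, MeasurableSet[ℱ k] (Set.univ : Set Ω) := fun _ => MeasurableSet.univ
  have hs : Measurable[ℱ 0] (fun _ : Ω => (1 : ℝ)) := measurable_const
  have hs1 : ∀ ω : Ω, (fun _ : Ω => (1 : ℝ)) ω ^ 2 = 1 := fun _ => one_pow 2
  set S := restrictedSum (fun _ => Set.univ) (fun _ : Ω => (1 : ℝ)) ξ with hS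
  have hSe : ∀ n ω, S n ω = ∑ k ∈ Finset.range n, ξ k ω := fun n ω => by simp [hS, restrictedSum]
  have hint : ∀ K, Integrable (S K) μ := fun K => by
    simpa using R.integrable_restrictedSum_pow hD hs hs1 K 1
  have hmart : Martingale S ℱ μ := by
    refine martingale_of_setIntegral_eq_succ
      (fun K => (R.measurable_restrictedSum hD hs K).stronglyMeasurable) hint fun K A hA => ?_
    have h0 := R.setIntegral_indicator_mul_noise hD hs hs1 K hA
    have h1 : Integrable
        (fun ω => (Set.univ : Set Ω).indicator (fun _ => (1 : ℝ)) ω * ξ K ω) μ := by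
      simpa using R.integrable_noise_pow K 1
    have h2 : ∀ ω, S (K + 1) ω =
        S K ω + (Set.univ : Set Ω).indicator (fun _ => (1 : ℝ)) ω * ξ K ω :=
      restrictedSum_succ _ _ _ _
    simp_rw [h2]
    rw [integral_add (hint K).integrableOn h1.integrableOn, h0, add_zero]
  have hbd : ∀ n, eLpNorm (S n) 1 μ ≤ (Real.toNNReal (1 + V) : NNReal) := by
    intro n
    have h2 := R.setIntegral_sq_restrictedSum_le hv hD hs hs1 (A := Set.univ) MeasurableSet.univ n
    rw [setIntegral_univ, probReal_univ, mul_one] at h2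
    rw [eLpNorm_one_eq_lintegral_enorm, ← ofReal_integral_norm_eq_lintegral_enorm (hint n)]
    change _ ≤ ENNReal.ofReal (1 + V)
    refine ENNReal.ofReal_le_ofReal ?_
    calc ∫ ω, ‖S n ω‖ ∂μ ≤ ∫ ω, (1 + S n ω ^ 2) ∂μ := by
          refine integral_mono (hint n).norm
            ((integrable_const _).add (R.integrable_restrictedSum_pow hD hs hs1 n 2)) fun ω => ?_
          simp only [Real.norm_eq_abs]
          nlinarith [sq_nonneg (|S n ω| - 1), sq_abs (S n ω), abs_nonneg (S n ω)]
      _ = 1 + ∫ ω, S n ω ^ 2 ∂μ := by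
          rw [integral_add (integrable_const _) (R.integrable_restrictedSum_pow hD hs hs1 n 2)]
          simp [hS]
      _ ≤ 1 + V := by linarith [hV n]
  filter_upwards [hmart.submartingale.ae_tendsto_limitProcess hbd] with ω hω
  exact ⟨_, by simpa only [hSe] using hω⟩

/-! ### Escape from the origin -/

omit [IsProbabilityMeasure μ] in
/-- Up to the exit from `{|z k| ≥ |z 0| / 2}` on the side of `z 0`, the drift only helps: `z` is
bounded below by its noise, so the noise must have been very negative at the exit. -/
lemma alive_dichotomy {D : ℕ → Set Ω} {s : Ω → ℝ} {A : Set Ω}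
    (hD : ∀ k ω, ω ∈ D k ↔ ω ∈ A ∧ ∀ j ≤ k, |z 0 ω| / 2 ≤ s ω * z j ω)
    (hs1 : ∀ ω, s ω ^ 2 = 1) (hs0 : ∀ ω, s ω * z 0 ω = |z 0 ω|)
    {ω : Ω} (hA : ω ∈ A) (hz : 0 < |z 0 ω|) (K : ℕ) :
    (ω ∈ D K → |z 0 ω| + restrictedSum D s ξ K ω ≤ s ω * z K ω) ∧
      (ω ∉ D K → restrictedSum D s ξ K ω ≤ - (|z 0 ω| / 2)) := by
  induction K with
  | zero =>
    have h0 : ω ∈ D 0 := (hD 0 ω).2 ⟨hA, fun j hj => by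
      rw [Nat.le_zero.1 hj, hs0]; linarith⟩
    exact ⟨fun _ => by simp [restrictedSum, hs0], fun h => absurd h0 h⟩
  | succ K ih =>
    rw [restrictedSum_succ]
    by_cases hK : ω ∈ D K
    · have h1 := ih.1 hK
      have h2 : |z 0 ω| / 2 ≤ s ω * z K ω := ((hD K ω).1 hK).2 K le_rfl
      have h3 : s ω * z K ω ≤ s ω * d K ω := by
        have h4 := R.sq_le_mul K ω
        have h5 : (s ω * z K ω) * (s ω * z K ω) ≤ (s ω * z K ω) * (s ω * d K ω) := by
          have e1 : (s ω * z K ω) * (s ω * z K ω) = z K ω ^ 2 := by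
            linear_combination z K ω ^ 2 * hs1 ω
          have e2 : (s ω * z K ω) * (s ω * d K ω) = z K ω * d K ω := by
            linear_combination z K ω * d K ω * hs1 ω
          rw [e1, e2]; exact h4
        exact le_of_mul_le_mul_left h5 (by linarith)
      have h6 : |z 0 ω| + (restrictedSum D s ξ K ω + s ω * ξ K ω) ≤ s ω * z (K + 1) ω := by
        rw [R.step]; linarith
      rw [Set.indicator_of_mem hK]
      refine ⟨fun _ => h6, fun h => ?_⟩
      have h7 : s ω * z (K + 1) ω < |z 0 ω| / 2 := by
        by_contra hcon
        push Not at hcon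
        refine h ((hD _ ω).2 ⟨hA, fun j hj => ?_⟩)
        rcases hj.lt_or_eq with hj | rfl
        · exact ((hD K ω).1 hK).2 j (by omega)
        · exact hcon
      linarith
    · have hK' : ω ∉ D (K + 1) := fun h => hK ((hD K ω).2
        ⟨hA, fun j hj => ((hD _ ω).1 h).2 j (by omega)⟩)
      refine ⟨fun h => absurd h hK', fun _ => ?_⟩
      simpa [hK] using ih.2 hK

/-- Escape: if `|z 0|` exceeds a multiple of the standard deviation `√V` of all the noise to come,
then with a probability bounded below `z` does not tend to `0`. This is a one-sided Chebyshev
(Cantelli) bound for the noise stopped when `z` first gets within `|z 0| / 2` of the origin. -/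
lemma escape {V q : ℝ} (hv : ∀ k, 0 ≤ v k) (hVpos : 0 < V)
    (hV : ∀ K, ∑ k ∈ Finset.range K, v k ≤ V) (hq : 0 < q) {A : Set Ω}
    (hA : MeasurableSet[ℱ 0] A) (hzA : ∀ ω ∈ A, 4 * q * V ≤ z 0 ω ^ 2) :
    (1 + q) * μ.real (A ∩ {ω | Tendsto (fun k => z k ω) atTop (𝓝 0)}) ≤ μ.real A := by
  classical
  set s : Ω → ℝ := fun ω => if 0 ≤ z 0 ω then 1 else -1 with hsdef
  have hs : Measurable[ℱ 0] s := by
    refine Measurable.ite ?_ measurable_const measurable_const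
    exact measurableSet_le measurable_const (R.measurable_z 0)
  have hs1 : ∀ ω, s ω ^ 2 = 1 := fun ω => by
    simp only [hsdef]; split_ifs <;> norm_num
  have hs0 : ∀ ω, s ω * z 0 ω = |z 0 ω| := fun ω => by
    simp only [hsdef]; split_ifs with h
    · rw [abs_of_nonneg h, one_mul]
    · rw [abs_of_neg (not_le.1 h)]; ring
  set D : ℕ → Set Ω := fun k => {ω | ω ∈ A ∧ ∀ j ≤ k, |z 0 ω| / 2 ≤ s ω * z j ω} with hDdef
  have hDiff : ∀ k ω, ω ∈ D k ↔ ω ∈ A ∧ ∀ j ≤ k, |z 0 ω| / 2 ≤ s ω * z j ω := fun _ _ => Iff.rfl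
  have hD : ∀ k, MeasurableSet[ℱ k] (D k) := by
    intro k
    have : D k = A ∩ ⋂ j ∈ Set.Iic k, {ω | |z 0 ω| / 2 ≤ s ω * z j ω} := by
      ext ω; simp [hDdef]
    rw [this]
    refine MeasurableSet.inter (ℱ.mono (Nat.zero_le k) _ hA)
      (MeasurableSet.biInter (Set.to_countable _) fun j hj => ?_)
    have h0 := (R.measurable_z 0).mono (ℱ.mono (Nat.zero_le k)) le_rfl
    refine measurableSet_le ?_ ?_
    · exact (continuous_abs.measurable.comp h0).div_const 2
    · exact (hs.mono (ℱ.mono (Nat.zero_le k)) le_rfl).mul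
        ((R.measurable_z j).mono (ℱ.mono hj) le_rfl)
  have hA0 := ℱ.le 0 _ hA
  have hzpos : ∀ ω ∈ A, 0 < |z 0 ω| := fun ω hω => by
    rw [abs_pos]; rintro h
    have := hzA ω hω
    rw [h] at this
    have : 0 < 4 * q * V := by positivity
    simp at *; linarith
  set lam : ℝ := Real.sqrt (q * V) with hlam
  have hlampos : 0 < lam := Real.sqrt_pos.2 (by positivity)
  have hlamsq : lam ^ 2 = q * V := Real.sq_sqrt (by positivity)
  have hzl : ∀ ω ∈ A, lam ≤ |z 0 ω| / 2 := fun ω hω => by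
    have h1 := hzA ω hω
    rw [← sq_abs] at h1
    refine le_of_sq_le_sq ?_ (by positivity)
    rw [hlamsq]; nlinarith
  have hbound : ∀ K, (1 + q) * μ.real (A \ D K) ≤ μ.real A := by
    intro K
    have hE : MeasurableSet (A \ D K) := hA0.diff (ℱ.le K _ (hD K))
    -- `b` minimises the Chebyshev bound `(b ^ 2 + V) / (b + lam) ^ 2`.
    set b : ℝ := V / lam with hb
    have hbpos : 0 < b := by positivity
    have hblam : b * lam = V := by rw [hb]; field_simp
    have hI1 := R.integrable_restrictedSum_pow (D := D) hD hs hs1 K 1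
    have hI2 := R.integrable_restrictedSum_pow (D := D) hD hs hs1 K 2
    simp only [pow_one] at hI1
    have hlin : Integrable (fun ω => b ^ 2 - 2 * b * restrictedSum D s ξ K ω) μ :=
      (integrable_const _).sub (hI1.const_mul _)
    have hI : Integrable (fun ω => (b - restrictedSum D s ξ K ω) ^ 2) μ := by
      have : (fun ω => (b - restrictedSum D s ξ K ω) ^ 2) = fun ω =>
          b ^ 2 - 2 * b * restrictedSum D s ξ K ω + restrictedSum D s ξ K ω ^ 2 := by
        ext ω; ring
      rw [this]
      exact hlin.add hI2
    have hup : ∫ ω in A, (b - restrictedSum D s ξ K ω) ^ 2 ∂μ ≤ (b ^ 2 + V) * μ.real A := by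
      have e : ∀ ω, (b - restrictedSum D s ξ K ω) ^ 2 =
          b ^ 2 - 2 * b * restrictedSum D s ξ K ω + restrictedSum D s ξ K ω ^ 2 := fun ω => by ring
      simp_rw [e]
      rw [integral_add hlin.integrableOn hI2.integrableOn,
        integral_sub (integrable_const _) (hI1.const_mul _).integrableOn, integral_const_mul,
        R.setIntegral_restrictedSum hD hs hs1 hA, setIntegral_const, smul_eq_mul]
      have h1 := R.setIntegral_sq_restrictedSum_le hv hD hs hs1 hA K
      have h2 : (∑ k ∈ Finset.range K, v k) * μ.real A ≤ V * μ.real A :=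
        mul_le_mul_of_nonneg_right (hV K) measureReal_nonneg
      linarith
    have hlow : (b + lam) ^ 2 * μ.real (A \ D K) ≤
        ∫ ω in A, (b - restrictedSum D s ξ K ω) ^ 2 ∂μ := by
      calc (b + lam) ^ 2 * μ.real (A \ D K) = ∫ ω in A \ D K, (b + lam) ^ 2 ∂μ := by
            rw [setIntegral_const, smul_eq_mul, mul_comm]
        _ ≤ ∫ ω in A \ D K, (b - restrictedSum D s ξ K ω) ^ 2 ∂μ := by
            refine setIntegral_mono_on (integrable_const _) hI.integrableOn hE fun ω hω => ?_
            have h1 := (R.alive_dichotomy hDiff hs1 hs0 hω.1 (hzpos ω hω.1) K).2 hω.2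
            have h2 := hzl ω hω.1
            exact pow_le_pow_left₀ (by positivity) (by linarith) 2
        _ ≤ _ := setIntegral_mono_set hI.integrableOn (ae_of_all _ fun ω => sq_nonneg _)
            (LE.le.eventuallyLE Set.sdiff_subset)
    have hall := hlow.trans hup
    have e1 : (b + lam) ^ 2 = (b ^ 2 + V) * (1 + q) := by
      have : b ^ 2 * q = V := by
        have h : b ^ 2 * q * V = V * V := by
          rw [mul_assoc, ← hlamsq]; linear_combination (b * lam + V) * hblam
        exact mul_right_cancel₀ hVpos.ne' h
      linear_combination 2 * hblam + hlamsq - this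
    rw [e1, mul_assoc] at hall
    exact le_of_mul_le_mul_left hall (by positivity)
  have hmono : Monotone fun K => A \ D K := fun i j hij ω hω =>
    ⟨hω.1, fun h => hω.2 ((hDiff _ _).2 ⟨h.1, fun l hl => h.2 l (hl.trans hij)⟩)⟩
  have hsub : A ∩ {ω | Tendsto (fun k => z k ω) atTop (𝓝 0)} ⊆ ⋃ K, A \ D K := by
    rintro ω ⟨hω, hlim⟩
    by_contra hcon
    simp only [Set.mem_iUnion, Set.mem_sdiff, not_exists, not_and, not_not] at hcon
    have h1 : ∀ k, |z 0 ω| / 2 ≤ s ω * z k ω := fun k => ((hDiff _ _).1 (hcon k hω)).2 k le_rfl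
    have h2 : Tendsto (fun k => s ω * z k ω) atTop (𝓝 (s ω * 0)) := hlim.const_mul _
    have h3 := ge_of_tendsto' h2 h1
    have h4 := hzpos ω hω
    simp at h3; linarith
  have hlim : Tendsto (fun K => μ.real (A \ D K)) atTop (𝓝 (μ.real (⋃ K, A \ D K))) :=
    (ENNReal.tendsto_toReal (measure_ne_top _ _)).comp (tendsto_measure_iUnion_atTop hmono)
  have h5 := le_of_tendsto' (hlim.const_mul (1 + q)) hbound
  refine le_trans ?_ h5
  exact mul_le_mul_of_nonneg_left (measureReal_mono hsub) (by positivity)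

/-! ### Leaving the scale of the noise -/

/-- Near the origin the second moment grows by at least an eighth of `v k`. -/
lemma setIntegral_sq_growth (k : ℕ) {A : Set Ω} (hA : MeasurableSet[ℱ k] A)
    (hz : ∀ ω ∈ A, |z k ω| < δ) :
    ∫ ω in A, z k ω ^ 2 ∂μ + v k / 8 * μ.real A ≤ ∫ ω in A, z (k + 1) ω ^ 2 ∂μ := by
  have hA0 := ℱ.le k _ hA
  have hcm : Measurable[ℱ k] (A.indicator fun ω => 2 * d k ω) :=
    ((R.measurable_d k).const_mul 2).indicator hA
  have hcb : ∀ ω, |A.indicator (fun ω => 2 * d k ω) ω| ≤ 2 := fun ω => by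
    by_cases h : ω ∈ A
    · simpa [h, abs_mul] using R.abs_d_le k ω
    · simp [h]
  have hmean : ∫ ω in A, 2 * d k ω * ξ k ω ∂μ = 0 := by
    rw [← R.mean k _ hcm ⟨2, hcb⟩, ← integral_indicator hA0]
    congr 1; ext ω
    by_cases h : ω ∈ A <;> simp [h]
  have hi : Integrable (fun ω => 2 * d k ω * ξ k ω) μ :=
    integrable_of_measurable_of_abs_le (C := 2 * 1 * 2)
      ((((R.measurable_d k).mono (ℱ.le _) le_rfl).const_mul 2).mul
        ((R.measurable_noise k).mono (ℱ.le _) le_rfl)) fun ω => by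
      rw [abs_mul, abs_mul, abs_two]
      gcongr
      · exact R.abs_d_le k ω
      · exact R.abs_noise_le k ω
  have hlin : Integrable (fun ω => z k ω ^ 2 + 2 * d k ω * ξ k ω) μ := (R.integrable_sq_z k).add hi
  have h1 : ∫ ω in A, (z k ω ^ 2 + 2 * d k ω * ξ k ω + ξ k ω ^ 2) ∂μ ≤
      ∫ ω in A, z (k + 1) ω ^ 2 ∂μ := by
    refine setIntegral_mono (hlin.add (R.integrable_noise_pow k 2)).integrableOn
      (R.integrable_sq_z (k + 1)).integrableOn fun ω => ?_
    have h2 := R.sq_le_mul k ω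
    simp only [R.step]
    nlinarith [sq_nonneg (d k ω - z k ω)]
  rw [integral_add hlin.integrableOn (R.integrable_noise_pow k 2).integrableOn,
    integral_add (R.integrable_sq_z k).integrableOn hi.integrableOn, hmean] at h1
  linarith [R.le_variance k A hA hz]

/-- The overshoot: on any event `E` the square of the next value is controlled by the probability
of `E`, up to an error that comes from the fourth moment of the noise. -/
lemma setIntegral_sq_overshoot_le (k : ℕ) {D E : Set Ω} (hD : MeasurableSet[ℱ k] D)
    (hE : MeasurableSet E) (hED : E ⊆ D) {θ r : ℝ} (hr : 0 < r) (hz : ∀ ω ∈ D, z k ω ^ 2 ≤ θ) :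
    ∫ ω in E, z (k + 1) ω ^ 2 ∂μ ≤
      (2 * L ^ 2 * θ + 2 * r) * μ.real E + 2 / r * (v k ^ 2 * μ.real D) := by
  have h4 := R.integrable_noise_pow k 4
  calc ∫ ω in E, z (k + 1) ω ^ 2 ∂μ
      ≤ ∫ ω in E, ((2 * L ^ 2 * θ + 2 * r) + 2 / r * ξ k ω ^ 4) ∂μ := by
        refine setIntegral_mono_on (R.integrable_sq_z _).integrableOn
          ((integrable_const _).add (h4.const_mul _)).integrableOn hE fun ω hω => ?_
        rw [R.step]
        have h1 : d k ω ^ 2 ≤ L ^ 2 * θ := by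
          have h2 := R.abs_d_le_mul k ω
          have h3 : |d k ω| ^ 2 ≤ (L * |z k ω|) ^ 2 := pow_le_pow_left₀ (abs_nonneg _) h2 2
          rw [mul_pow, sq_abs, sq_abs] at h3
          exact h3.trans (mul_le_mul_of_nonneg_left (hz ω (hED hω)) (sq_nonneg L))
        -- Either `ξ ^ 2 ≤ r`, or `ξ ^ 2 ≤ ξ ^ 4 / r`.
        have h5 : ξ k ω ^ 2 ≤ r + 1 / r * ξ k ω ^ 4 := by
          have h6 : 0 ≤ 1 / r * (ξ k ω ^ 2 - r) ^ 2 + ξ k ω ^ 2 := by positivity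
          have h7 : 1 / r * (ξ k ω ^ 2 - r) ^ 2 = 1 / r * ξ k ω ^ 4 - 2 * ξ k ω ^ 2 + r := by
            field_simp; ring
          linarith
        have h8 : 2 / r * ξ k ω ^ 4 = 2 * (1 / r * ξ k ω ^ 4) := by ring
        rw [h8]
        nlinarith [sq_nonneg (d k ω - ξ k ω)]
    _ = (2 * L ^ 2 * θ + 2 * r) * μ.real E + 2 / r * ∫ ω in E, ξ k ω ^ 4 ∂μ := by
        rw [integral_add (integrable_const _) (h4.const_mul _).integrableOn, setIntegral_const,
          integral_const_mul, smul_eq_mul, mul_comm (μ.real E)]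
    _ ≤ _ := by
        gcongr
        refine le_trans ?_ (R.fourth_le k D hD)
        exact setIntegral_mono_set h4.integrableOn
          (ae_of_all _ fun ω => Even.pow_nonneg (by decide) _) (LE.le.eventuallyLE hED)

omit [IsProbabilityMeasure μ] in
lemma measurableSet_confined {θ : ℝ} {A : Set Ω} (hA : MeasurableSet[ℱ 0] A) (k : ℕ) :
    MeasurableSet[ℱ k] (confined z θ A k) := by
  have : confined z θ A k = A ∩ ⋂ j ∈ Set.Iic k, {ω | z j ω ^ 2 < θ} := by
    ext ω; simp [confined]
  rw [this]
  refine MeasurableSet.inter (ℱ.mono (Nat.zero_le k) _ hA)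
    (MeasurableSet.biInter (Set.to_countable _) fun j hj => ?_)
  exact measurableSet_lt (((R.measurable_z j).mono (ℱ.mono hj) le_rfl).pow_const 2)
    measurable_const

/-- Hitting: once `v` has spent half of its total mass `V`, the process has left the interval
`z ^ 2 < 4 * q * V` with a probability bounded below: otherwise its second moment would have grown
by a fixed multiple of `V`, while a confined process has no room for that and the overshoot at the
exit is small by `setIntegral_sq_overshoot_le`. -/
lemma hit {V q : ℝ} (hv : ∀ k, 0 ≤ v k) (hVpos : 0 < V)
    (hV : ∀ K, ∑ k ∈ Finset.range K, v k ≤ V) (hq1 : 256 * q ≤ 1) (hδ : 0 < δ)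
    (hqδ : 4 * q * V ≤ δ ^ 2) {A : Set Ω} (hA : MeasurableSet[ℱ 0] A) {m : ℕ}
    (hm : V / 2 ≤ ∑ k ∈ Finset.range m, v k) :
    μ.real A ≤ 32 * (L ^ 2 + 257) * μ.real (A \ confined z (4 * q * V) A m) := by
  set D := confined z (4 * q * V) A with hDdef
  have hD : ∀ k, MeasurableSet[ℱ k] (D k) := R.measurableSet_confined hA
  have hD0 : ∀ k, MeasurableSet (D k) := fun k => ℱ.le k _ (hD k)
  have hDA : ∀ k, D k ⊆ A := confined_subset z _ A
  have hDs : ∀ k, D (k + 1) ⊆ D k := confined_succ_subset z _ A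
  have hvV : ∀ k, v k ≤ V := fun k =>
    (Finset.single_le_sum (fun i _ => hv i) (Finset.self_mem_range_succ k)).trans (hV (k + 1))
  -- The growth of the second moment, telescoped along the events `D k`. The level `r = 128 * V` of
  -- the overshoot bound makes the fourth moments contribute at most `V / 64`.
  have key : ∀ k, (∑ i ∈ Finset.range k, v i) / 8 * μ.real (D k) ≤
      ∫ ω in D k, z k ω ^ 2 ∂μ +
        (8 * L ^ 2 * q + 256) * V * (μ.real (D 0) - μ.real (D k)) +
        (∑ i ∈ Finset.range k, v i) / 64 * μ.real A := by
    intro k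
    induction k with
    | zero =>
      simp only [Finset.range_zero, Finset.sum_empty, zero_div, zero_mul, sub_self, mul_zero,
        add_zero]
      exact integral_nonneg fun ω => sq_nonneg _
    | succ k ih =>
      have hz : ∀ ω ∈ D k, z k ω ^ 2 < 4 * q * V := fun ω hω => hω.2 k le_rfl
      have h1 := R.setIntegral_sq_growth k (hD k) fun ω hω =>
        abs_lt_of_sq_lt_sq ((hz ω hω).trans_le hqδ) hδ.le
      have hE : MeasurableSet (D k \ D (k + 1)) := (hD0 k).diff (hD0 (k + 1))
      have h2 := R.setIntegral_sq_overshoot_le k (hD k) hE Set.sdiff_subset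
        (r := 128 * V) (by positivity) fun ω hω => (hz ω hω).le
      have h3 : ∫ ω in D k, z (k + 1) ω ^ 2 ∂μ = ∫ ω in D (k + 1), z (k + 1) ω ^ 2 ∂μ +
          ∫ ω in D k \ D (k + 1), z (k + 1) ω ^ 2 ∂μ := by
        rw [← setIntegral_union Set.disjoint_sdiff_right hE
          (R.integrable_sq_z _).integrableOn (R.integrable_sq_z _).integrableOn,
          Set.union_sdiff_cancel (hDs k)]
      have h4 : μ.real (D k \ D (k + 1)) = μ.real (D k) - μ.real (D (k + 1)) :=
        measureReal_sdiff (hDs k) (hD0 (k + 1))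
      have h5 : 2 / (128 * V) * (v k ^ 2 * μ.real (D k)) ≤ v k / 64 * μ.real A := by
        have : v k ^ 2 * μ.real (D k) ≤ v k * V * μ.real A := by
          rw [sq]
          have hvk := hv k
          have hDk : μ.real (D k) ≤ μ.real A := measureReal_mono (hDA k)
          exact mul_le_mul (mul_le_mul_of_nonneg_left (hvV k) hvk) hDk measureReal_nonneg
            (by positivity)
        calc 2 / (128 * V) * (v k ^ 2 * μ.real (D k))
            ≤ 2 / (128 * V) * (v k * V * μ.real A) := by gcongr
          _ = v k / 64 * μ.real A := by field_simp; ring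
      have h6 : μ.real (D (k + 1)) ≤ μ.real (D k) := measureReal_mono (hDs k)
      have h7 : (∑ i ∈ Finset.range k, v i + v k) / 8 * μ.real (D (k + 1)) ≤
          (∑ i ∈ Finset.range k, v i + v k) / 8 * μ.real (D k) := by
        have : 0 ≤ ∑ i ∈ Finset.range k, v i := Finset.sum_nonneg fun i _ => hv i
        have := hv k
        gcongr
      rw [Finset.sum_range_succ]
      rw [h4] at h2
      have h8 : (2 * L ^ 2 * (4 * q * V) + 2 * (128 * V)) = (8 * L ^ 2 * q + 256) * V := by ring
      rw [h8] at h2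
      linarith
  have hk := key m
  have h1 : ∫ ω in D m, z m ω ^ 2 ∂μ ≤ 4 * q * V * μ.real (D m) := by
    calc ∫ ω in D m, z m ω ^ 2 ∂μ ≤ ∫ ω in D m, 4 * q * V ∂μ :=
          setIntegral_mono_on (R.integrable_sq_z m).integrableOn (integrable_const _) (hD0 m)
            fun ω hω => (hω.2 m le_rfl).le
      _ = _ := by rw [setIntegral_const, smul_eq_mul, mul_comm]
  have h2 : μ.real (A \ D m) = μ.real A - μ.real (D m) := measureReal_sdiff (hDA m) (hD0 m)
  have h3 : μ.real (D 0) ≤ μ.real A := measureReal_mono (hDA 0)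
  have hmA : μ.real (D m) ≤ μ.real A := measureReal_mono (hDA m)
  have hDm : 0 ≤ μ.real (D m) := measureReal_nonneg
  have h4 : V / 2 / 8 * μ.real (D m) ≤ (∑ k ∈ Finset.range m, v k) / 8 * μ.real (D m) := by
    gcongr
  have h5 : (∑ k ∈ Finset.range m, v k) / 64 * μ.real A ≤ V / 64 * μ.real A := by
    gcongr; exact hV m
  have h6 : (8 * L ^ 2 * q + 256) * V * (μ.real (D 0) - μ.real (D m)) ≤
      (L ^ 2 + 256) * V * (μ.real A - μ.real (D m)) := by
    have : 8 * L ^ 2 * q ≤ L ^ 2 := by nlinarith [sq_nonneg L]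
    have h0 : μ.real (D m) ≤ μ.real (D 0) :=
      measureReal_mono fun ω hω => ⟨hω.1, fun j hj => hω.2 j (by omega)⟩
    have := sub_nonneg.2 h0
    exact mul_le_mul (mul_le_mul_of_nonneg_right (by linarith) hVpos.le) (by linarith) this
      (by positivity)
  have h7 : 4 * q * V * μ.real (D m) ≤ V / 64 * μ.real A := by
    have : 4 * q * V ≤ V / 64 := by nlinarith
    gcongr
  rw [h2]
  have h8 : V * μ.real A ≤
      V * (32 * (L ^ 2 + 257) * (μ.real A - μ.real (D m))) := by
    nlinarith [mul_nonneg hVpos.le (sub_nonneg.2 hmA)]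
  exact le_of_mul_le_mul_left h8 hVpos

/-- Leaving the interval `z ^ 2 < 4 * q * V` entails, by `escape` at the exit time, a chance not to
come back to the origin. -/
lemma escape_of_exit {V q : ℝ} (hv : ∀ k, 0 ≤ v k) (hVpos : 0 < V)
    (hV : ∀ K, ∑ k ∈ Finset.range K, v k ≤ V) (hq : 0 < q) {A : Set Ω}
    (hA : MeasurableSet[ℱ 0] A) (m : ℕ) :
    (1 + q) * μ.real ((A \ confined z (4 * q * V) A m) ∩
      {ω | Tendsto (fun k => z k ω) atTop (𝓝 0)}) ≤
      μ.real (A \ confined z (4 * q * V) A m) := by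
  set D := confined z (4 * q * V) A with hDdef
  set G := {ω | Tendsto (fun k => z k ω) atTop (𝓝 0)} with hG
  have hD : ∀ k, MeasurableSet[ℱ k] (D k) := R.measurableSet_confined hA
  have hDA : ∀ k, D k ⊆ A := confined_subset z _ A
  have hDs : ∀ k, D (k + 1) ⊆ D k := confined_succ_subset z _ A
  induction m with
  | zero =>
    refine R.escape hv hVpos hV hq (hA.diff (hD 0)) fun ω hω => ?_
    by_contra hcon
    refine hω.2 ⟨hω.1, fun j hj => ?_⟩
    rw [Nat.le_zero.1 hj]
    exact not_le.1 hcon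
  | succ m ih =>
    have hE : MeasurableSet[ℱ (m + 1)] (D m \ D (m + 1)) :=
      (ℱ.mono (Nat.le_succ m) _ (hD m)).diff (hD (m + 1))
    have hVs : ∀ K, ∑ k ∈ Finset.range K, v (m + 1 + k) ≤ V := fun K => by
      have h1 := hV (m + 1 + K)
      rw [Finset.sum_range_add] at h1
      have : 0 ≤ ∑ k ∈ Finset.range (m + 1), v k := Finset.sum_nonneg fun i _ => hv i
      linarith
    have h1 := (R.shift (m + 1)).escape (A := D m \ D (m + 1)) (fun k => hv _) hVpos hVs hq hE
      fun ω hω => by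
        by_contra hcon
        refine hω.2 ⟨hDA m hω.1, fun j hj => ?_⟩
        rcases hj.lt_or_eq with hj | rfl
        · exact hω.1.2 j (by omega)
        · exact not_le.1 hcon
    have hGs : {ω | Tendsto (fun k => z (m + 1 + k) ω) atTop (𝓝 0)} = G := by
      ext ω
      simp only [hG, Set.mem_ofPred_eq, add_comm (m + 1)]
      exact tendsto_add_atTop_iff_nat (f := fun k => z k ω) (m + 1)
    rw [hGs] at h1
    have hunion : A \ D (m + 1) = (A \ D m) ∪ (D m \ D (m + 1)) := by
      ext ω
      have := @hDs m ω
      have := @hDA m ω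
      simp only [Set.mem_sdiff, Set.mem_union]; tauto
    have hdis : Disjoint (A \ D m) (D m \ D (m + 1)) :=
      Set.disjoint_left.2 fun ω h h' => h.2 h'.1
    have h2 : μ.real (A \ D (m + 1)) = μ.real (A \ D m) + μ.real (D m \ D (m + 1)) := by
      rw [hunion, measureReal_union hdis (ℱ.le _ _ hE)]
    have h3 : μ.real (A \ D (m + 1) ∩ G) ≤
        μ.real (A \ D m ∩ G) + μ.real (D m \ D (m + 1) ∩ G) := by
      rw [hunion, Set.union_inter_distrib_right]
      exact measureReal_union_le _ _
    rw [h2]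
    have h4 := mul_le_mul_of_nonneg_left h3 (by linarith : 0 ≤ 1 + q)
    linarith

/-- From any position, with a chance bounded below that does not depend on `V`, the process leaves
the scale `√V` and then does not converge to the origin. -/
lemma measureReal_inter_tendsto_le {V q : ℝ} (hv : ∀ k, 0 ≤ v k) (hVpos : 0 < V)
    (hV : HasSum v V) (hq : 0 < q) (hq1 : 256 * q ≤ 1) (hδ : 0 < δ)
    (hqδ : 4 * q * V ≤ δ ^ 2) {A : Set Ω} (hA : MeasurableSet[ℱ 0] A) :
    μ.real (A ∩ {ω | Tendsto (fun k => z k ω) atTop (𝓝 0)}) ≤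
      (1 - q / ((1 + q) * (32 * (L ^ 2 + 257)))) * μ.real A := by
  have hVK : ∀ K, ∑ k ∈ Finset.range K, v k ≤ V := fun K =>
    sum_le_hasSum _ (fun i _ => hv i) hV
  obtain ⟨m, hm⟩ := (hV.tendsto_sum_nat.eventually (lt_mem_nhds (half_lt_self hVpos))).exists
  have h1 := R.hit hv hVpos hVK hq1 hδ hqδ hA hm.le
  have h2 := R.escape_of_exit hv hVpos hVK hq hA m
  set D := confined z (4 * q * V) A m with hD
  set G := {ω | Tendsto (fun k => z k ω) atTop (𝓝 0)} with hG
  have hDA : D ⊆ A := confined_subset z _ A m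
  have h3 : μ.real (A \ D) = μ.real A - μ.real D :=
    measureReal_sdiff hDA (ℱ.le m _ (R.measurableSet_confined hA m))
  have h4 : μ.real (A ∩ G) ≤ μ.real D + μ.real ((A \ D) ∩ G) := by
    refine le_trans (measureReal_mono ?_) (measureReal_union_le _ _)
    rintro ω ⟨hω, hg⟩
    by_cases h : ω ∈ D
    · exact Or.inl h
    · exact Or.inr ⟨⟨hω, h⟩, hg⟩
  have hM : 0 < 32 * (L ^ 2 + 257) := by positivity
  have h5 : q / ((1 + q) * (32 * (L ^ 2 + 257))) * μ.real A ≤ q / (1 + q) * μ.real (A \ D) := by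
    calc q / ((1 + q) * (32 * (L ^ 2 + 257))) * μ.real A
        ≤ q / ((1 + q) * (32 * (L ^ 2 + 257))) * (32 * (L ^ 2 + 257) * μ.real (A \ D)) := by gcongr
      _ = q / (1 + q) * μ.real (A \ D) := by field_simp
  have h6 : μ.real ((A \ D) ∩ G) ≤ (1 - q / (1 + q)) * μ.real (A \ D) := by
    have : 1 - q / (1 + q) = 1 / (1 + q) := by field_simp; ring
    rw [this, div_mul_eq_mul_div, one_mul, le_div_iff₀ (by linarith)]
    linarith
  linarith

/-- A noisy recursion almost surely does not converge to the origin: by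
`measureReal_inter_tendsto_le`, applied after any time `n`, the conditional probability of this
event given `ℱ n` stays away from `1`, while it tends to the indicator by Lévy's theorem. -/
theorem ae_not_tendsto_zero (hv : ∀ k, 0 < v k) (hs : Summable v) (hδ : 0 < δ) :
    ∀ᵐ ω ∂μ, ¬ Tendsto (fun k => z k ω) atTop (𝓝 0) := by
  set V₀ := ∑' k, v k with hV₀
  have hV₀pos : 0 < V₀ := hs.tsum_pos (fun i => (hv i).le) 0 (hv 0)
  set q : ℝ := min (1 / 256) (δ ^ 2 / (4 * V₀)) with hqdef
  have hq : 0 < q := by positivity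
  have hq1 : 256 * q ≤ 1 := by
    have : q ≤ 1 / 256 := min_le_left _ _
    linarith
  have hqδ : 4 * q * V₀ ≤ δ ^ 2 := by
    have h : q ≤ δ ^ 2 / (4 * V₀) := min_le_right _ _
    rw [le_div_iff₀ (by positivity)] at h
    linarith
  set G := {ω | Tendsto (fun k => z k ω) atTop (𝓝 0)} with hG
  set c : ℝ := q / ((1 + q) * (32 * (L ^ 2 + 257))) with hc
  have hcpos : 0 < c := by positivity
  have hGm : MeasurableSet[⨆ n, ℱ n] G :=
    measurableSet_tendsto (𝓝 0) fun k => (R.measurable_z k).mono (le_iSup (fun n => ℱ n) k) le_rfl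
  have hsup : (⨆ n, ℱ n) ≤ m0 := iSup_le fun n => ℱ.le n
  have hGm0 : MeasurableSet G := hsup _ hGm
  have hn : ∀ n A, MeasurableSet[ℱ n] A → μ.real (A ∩ G) ≤ (1 - c) * μ.real A := by
    intro n A hA
    have hsn : Summable fun k => v (n + k) := by
      simpa [add_comm] using (summable_nat_add_iff n).2 hs
    have hVle : ∑' k, v (n + k) ≤ V₀ := by
      have h1 := hs.sum_add_tsum_nat_add n
      have h2 : 0 ≤ ∑ i ∈ Finset.range n, v i := Finset.sum_nonneg fun i _ => (hv i).le
      simp only [add_comm n]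
      linarith
    have h := (R.shift n).measureReal_inter_tendsto_le (fun k => (hv _).le)
      (hsn.tsum_pos (fun i => (hv _).le) 0 (hv _)) hsn.hasSum hq hq1 hδ
      ((mul_le_mul_of_nonneg_left hVle (by positivity)).trans hqδ) (A := A) hA
    have hGs : {ω | Tendsto (fun k => z (n + k) ω) atTop (𝓝 0)} = G := by
      ext ω
      simp only [hG, Set.mem_ofPred_eq, add_comm n]
      exact tendsto_add_atTop_iff_nat (f := fun k => z k ω) n
    rwa [hGs] at h
  set g : Ω → ℝ := G.indicator fun _ => 1 with hg
  have hgi : Integrable g μ := (integrable_const _).indicator hGm0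
  have hle : ∀ n, ∀ᵐ ω ∂μ, (μ[g | ℱ n]) ω ≤ 1 - c := by
    intro n
    have hcm : Measurable[ℱ n] (μ[g | ℱ n]) := stronglyMeasurable_condExp.measurable
    set A := {ω | 1 - c < (μ[g | ℱ n]) ω} with hAdef
    have hA : MeasurableSet[ℱ n] A := measurableSet_lt measurable_const hcm
    have hA0 := ℱ.le n _ hA
    have h1 : ∫ ω in A, (μ[g | ℱ n]) ω ∂μ = μ.real (A ∩ G) := by
      rw [setIntegral_condExp (ℱ.le n) hgi hA, hg, setIntegral_indicator hGm0, setIntegral_const,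
        smul_eq_mul, mul_one]
    have h2 : ∫ ω in A, ((μ[g | ℱ n]) ω - (1 - c)) ∂μ ≤ 0 := by
      rw [integral_sub integrable_condExp.integrableOn (integrable_const _), h1, setIntegral_const,
        smul_eq_mul]
      linarith [hn n A hA]
    have h3 : 0 ≤ᵐ[μ.restrict A] fun ω => (μ[g | ℱ n]) ω - (1 - c) :=
      (ae_restrict_iff' hA0).2 (ae_of_all _ fun ω hω => by
        have : 1 - c < (μ[g | ℱ n]) ω := hω
        simp only [Pi.zero_apply]; linarith)
    have h4 := (integral_eq_zero_iff_of_nonneg_ae h3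
      ((integrable_condExp.sub (integrable_const _)).integrableOn)).1
      (le_antisymm h2 (integral_nonneg_of_ae h3))
    filter_upwards [(ae_restrict_iff' hA0).1 h4] with ω hω
    by_contra hcon
    have h5 : 1 - c < (μ[g | ℱ n]) ω := not_le.1 hcon
    have h6 := hω h5
    simp only [Pi.zero_apply] at h6
    linarith
  have hlevy := hgi.tendsto_ae_condExp (ℱ := ℱ)
    (StronglyMeasurable.indicator stronglyMeasurable_const hGm)
  filter_upwards [hlevy, ae_all_iff.2 hle] with ω h1 h2 hω
  have h3 := le_of_tendsto' h1 h2
  have h4 : g ω = 1 := by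
    have : ω ∈ G := hω
    simp [hg, this]
  linarith

end NoisyRecursion

end NoisyRecursion

/-! ### Deterministic estimates on the total number of balls -/

section TotalBalls

variable {τ₀ : ℕ} {σ : ℕ → ℕ}

lemma totalBalls_succ (n : ℕ) :
    totalBalls τ₀ σ (n + 1) = totalBalls τ₀ σ n + σ (n + 1) := by
  unfold totalBalls
  rw [Finset.sum_Icc_succ_top (by omega), add_assoc]

lemma totalBalls_pos (hτ : 0 < τ₀) (n : ℕ) : 0 < totalBalls τ₀ σ n :=
  Nat.add_pos_left hτ _

lemma totalBalls_add_le (hσ : ∀ n, 1 ≤ n → 0 < σ n) (n m : ℕ) :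
    totalBalls τ₀ σ n + m ≤ totalBalls τ₀ σ (n + m) := by
  induction m with
  | zero => rfl
  | succ m ih =>
    rw [← add_assoc n m 1, totalBalls_succ]
    have := hσ (n + m + 1) (by omega)
    omega

/-- The weight `σ_{n+1} / τ_{n+1}` of the new balls in the proportion at time `n + 1`. -/
noncomputable def newWeight (τ₀ : ℕ) (σ : ℕ → ℕ) (n : ℕ) : ℝ :=
  (σ (n + 1) : ℝ) / totalBalls τ₀ σ (n + 1)

/-- The order of magnitude `σ_{n+1} / τ_{n+1} ^ 2` of the conditional variance of the proportion at
time `n + 1`. -/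
noncomputable def noiseScale (τ₀ : ℕ) (σ : ℕ → ℕ) (n : ℕ) : ℝ :=
  (σ (n + 1) : ℝ) / (totalBalls τ₀ σ (n + 1) : ℝ) ^ 2

lemma newWeight_nonneg (n : ℕ) : 0 ≤ newWeight τ₀ σ n := by
  unfold newWeight; positivity

lemma newWeight_le_one (n : ℕ) : newWeight τ₀ σ n ≤ 1 := by
  unfold newWeight
  refine div_le_one_of_le₀ ?_ (by positivity)
  exact_mod_cast (by rw [totalBalls_succ]; omega : σ (n + 1) ≤ totalBalls τ₀ σ (n + 1))

lemma noiseScale_pos (hτ : 0 < τ₀) (hσ : ∀ n, 1 ≤ n → 0 < σ n) (n : ℕ) :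
    0 < noiseScale τ₀ σ n := by
  have h1 : (0 : ℝ) < σ (n + 1) := by exact_mod_cast hσ (n + 1) (by omega)
  have h2 : (0 : ℝ) < totalBalls τ₀ σ (n + 1) := by exact_mod_cast totalBalls_pos hτ _
  unfold noiseScale; positivity

/-- By comparison with a telescoping sum, the noise scales are summable. -/
lemma summable_noiseScale (hτ : 0 < τ₀) : Summable (noiseScale τ₀ σ) := by
  refine summable_of_sum_range_le (c := 1 / (totalBalls τ₀ σ 0 : ℝ))
    (fun n => by unfold noiseScale; positivity) fun n => ?_
  have h : ∑ k ∈ Finset.range n, noiseScale τ₀ σ k ≤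
      1 / (totalBalls τ₀ σ 0 : ℝ) - 1 / (totalBalls τ₀ σ n : ℝ) := by
    induction n with
    | zero => simp
    | succ n ih =>
      rw [Finset.sum_range_succ]
      have h1 : (0 : ℝ) < totalBalls τ₀ σ n := by exact_mod_cast totalBalls_pos hτ _
      have h2 : (totalBalls τ₀ σ (n + 1) : ℝ) = totalBalls τ₀ σ n + σ (n + 1) := by
        exact_mod_cast totalBalls_succ n
      have h3 : (0 : ℝ) ≤ σ (n + 1) := Nat.cast_nonneg _
      have h4 : noiseScale τ₀ σ n ≤
          1 / (totalBalls τ₀ σ n : ℝ) - 1 / (totalBalls τ₀ σ (n + 1) : ℝ) := by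
        unfold noiseScale
        rw [h2]
        have : 1 / (totalBalls τ₀ σ n : ℝ) - 1 / ((totalBalls τ₀ σ n : ℝ) + σ (n + 1)) =
            σ (n + 1) / (totalBalls τ₀ σ n * ((totalBalls τ₀ σ n : ℝ) + σ (n + 1))) := by
          field_simp; ring
        rw [this]
        gcongr
        nlinarith
      linarith
  have : 0 ≤ 1 / (totalBalls τ₀ σ n : ℝ) := by positivity
  linarith

/-- The weights of the new balls between times `n` and `n + m` add up to at least
`(τ_{n+m} - τ_n) / τ_{n+m}`, which is not small for `m` large. -/
lemma not_summable_newWeight (hτ : 0 < τ₀) (hσ : ∀ n, 1 ≤ n → 0 < σ n) :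
    ¬ Summable (newWeight τ₀ σ) := by
  intro hs
  obtain ⟨n, hn⟩ := ((tendsto_sum_nat_add (newWeight τ₀ σ)).eventually
    (gt_mem_nhds (by norm_num : (0 : ℝ) < 1 / 2))).exists
  have hle : ∀ m, ((totalBalls τ₀ σ (n + m) : ℝ) - totalBalls τ₀ σ n) / totalBalls τ₀ σ (n + m) ≤
      ∑ k ∈ Finset.range m, newWeight τ₀ σ (k + n) := by
    intro m
    induction m with
    | zero => simp
    | succ m ih =>
      rw [Finset.sum_range_succ, ← add_assoc, add_comm m n]
      refine le_trans ?_ (add_le_add_left ih _)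
      have h1 : (0 : ℝ) < totalBalls τ₀ σ (n + m) := by exact_mod_cast totalBalls_pos hτ _
      have h2 : (totalBalls τ₀ σ (n + m + 1) : ℝ) = totalBalls τ₀ σ (n + m) + σ (n + m + 1) := by
        exact_mod_cast totalBalls_succ (n + m)
      have h3 : (0 : ℝ) ≤ σ (n + m + 1) := Nat.cast_nonneg _
      have h4 : (totalBalls τ₀ σ n : ℝ) ≤ totalBalls τ₀ σ (n + m) := by
        exact_mod_cast (Nat.le_add_right _ m).trans (totalBalls_add_le hσ n m)
      unfold newWeight
      rw [h2]
      have : ((totalBalls τ₀ σ (n + m) : ℝ) + σ (n + m + 1) - totalBalls τ₀ σ n) /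
          (totalBalls τ₀ σ (n + m) + σ (n + m + 1)) =
          ((totalBalls τ₀ σ (n + m) : ℝ) - totalBalls τ₀ σ n) /
            (totalBalls τ₀ σ (n + m) + σ (n + m + 1)) +
          σ (n + m + 1) / (totalBalls τ₀ σ (n + m) + σ (n + m + 1)) := by ring
      rw [this]
      gcongr
      linarith
  -- After `τ_n` more steps the total number of balls has at least doubled.
  have h1 := hle (totalBalls τ₀ σ n)
  have h2 : ∑ k ∈ Finset.range (totalBalls τ₀ σ n), newWeight τ₀ σ (k + n) ≤
      ∑' k, newWeight τ₀ σ (k + n) :=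
    ((summable_nat_add_iff n).2 hs).sum_le_tsum _ fun _ _ => newWeight_nonneg _
  have h3 : (totalBalls τ₀ σ n : ℝ) + totalBalls τ₀ σ n ≤
      totalBalls τ₀ σ (n + totalBalls τ₀ σ n) := by
    exact_mod_cast totalBalls_add_le hσ n _
  have h4 : (0 : ℝ) < totalBalls τ₀ σ n := by exact_mod_cast totalBalls_pos hτ _
  have h5 : (1 : ℝ) / 2 ≤ ((totalBalls τ₀ σ (n + totalBalls τ₀ σ n) : ℝ) - totalBalls τ₀ σ n) /
      totalBalls τ₀ σ (n + totalBalls τ₀ σ n) := by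
    rw [le_div_iff₀ (by linarith)]
    linarith
  linarith

end TotalBalls

/-! ### The balls and bins process as a noisy recursion -/

section ProportionProcess

variable {Ω : Type*} [mΩ : MeasurableSpace Ω] {μ : Measure Ω} {α : ℝ} {T₀ τ₀ : ℕ} {σ : ℕ → ℕ}
  {B : ℕ → Ω → ℕ}

/-- The filtration of the sigma-algebras `history B n`. -/
def historyFiltration (hB : ∀ n, Measurable (B n)) : Filtration ℕ mΩ where
  seq n := history B n
  mono' i j hij := iSup₂_le fun k hk => by
    simp only [Finset.mem_Icc] at hk
    exact le_iSup₂_of_le (f := fun i (_ : i ∈ Finset.Icc 1 j) => MeasurableSpace.comap (B i) ⊤)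
      k (Finset.mem_Icc.2 ⟨hk.1, hk.2.trans hij⟩) le_rfl
  le' _ := iSup₂_le fun k _ => (hB k).comap_le

/-- The numbers of balls received by the first bin, cut off at `σ n`. The cut-off only acts on a
null event, and makes the proportion of balls lie in `[0, 1]` everywhere. -/
def cutoff (σ : ℕ → ℕ) (B : ℕ → Ω → ℕ) (n : ℕ) (ω : Ω) : ℕ := min (B n ω) (σ n)

omit mΩ in
lemma measurable_history {n k : ℕ} (hk : k + 1 ≤ n) : Measurable[history B n] (B (k + 1)) := by
  have h : MeasurableSpace.comap (B (k + 1)) ⊤ ≤ history B n :=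
    le_iSup₂_of_le (f := fun i (_ : i ∈ Finset.Icc 1 n) => MeasurableSpace.comap (B i) ⊤)
      (k + 1) (Finset.mem_Icc.2 ⟨by omega, hk⟩) le_rfl
  exact measurable_iff_comap_le.2 h

omit mΩ in
lemma measurable_cutoff {n k : ℕ} (hk : k + 1 ≤ n) :
    Measurable[history B n] (cutoff σ B (k + 1)) :=
  (measurable_from_top (f := fun b : ℕ => min b (σ (k + 1)))).comp (measurable_history hk)

omit mΩ in
lemma measurable_firstBin_cutoff (n : ℕ) :
    ∀ k ≤ n, Measurable[history B n] (firstBin T₀ (cutoff σ B) k) := by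
  intro k
  induction k with
  | zero => exact fun _ => measurable_const
  | succ k ih =>
    intro hk
    exact (ih (by omega)).add (measurable_cutoff hk)

omit mΩ in
lemma measurable_proportion_cutoff (n : ℕ) :
    Measurable[history B n] (proportion T₀ τ₀ σ (cutoff σ B) n) :=
  ((measurable_from_top (f := fun b : ℕ => (b : ℝ))).comp
    (measurable_firstBin_cutoff n n le_rfl)).div_const _

omit mΩ in
lemma firstBin_cutoff_le (hT : T₀ ≤ τ₀) (n : ℕ) (ω : Ω) :
    firstBin T₀ (cutoff σ B) n ω ≤ totalBalls τ₀ σ n := by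
  induction n with
  | zero => simpa [firstBin, totalBalls] using hT
  | succ n ih =>
    rw [totalBalls_succ]
    exact add_le_add ih (min_le_right _ _)

omit mΩ in
lemma proportion_cutoff_nonneg (n : ℕ) (ω : Ω) :
    0 ≤ proportion T₀ τ₀ σ (cutoff σ B) n ω := by
  unfold proportion; positivity

omit mΩ in
lemma proportion_cutoff_le_one (hT : T₀ ≤ τ₀) (n : ℕ) (ω : Ω) :
    proportion T₀ τ₀ σ (cutoff σ B) n ω ≤ 1 :=
  div_le_one_of_le₀ (by exact_mod_cast firstBin_cutoff_le hT n ω) (by positivity)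

/-- The random part `(B_{n+1} - σ_{n+1} P_n) / τ_{n+1}` of the increment of the proportion. -/
noncomputable def proportionNoise (α : ℝ) (T₀ τ₀ : ℕ) (σ : ℕ → ℕ) (B : ℕ → Ω → ℕ) (n : ℕ) (ω : Ω) :
    ℝ :=
  ((B (n + 1) ω : ℝ) - σ (n + 1) * feedback α (proportion T₀ τ₀ σ B n ω)) /
    totalBalls τ₀ σ (n + 1)

omit mΩ in
lemma proportion_succ (hτ : 0 < τ₀) (B : ℕ → Ω → ℕ) (n : ℕ) (ω : Ω) :
    proportion T₀ τ₀ σ B (n + 1) ω = proportion T₀ τ₀ σ B n ω +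
      newWeight τ₀ σ n * (feedback α (proportion T₀ τ₀ σ B n ω) - proportion T₀ τ₀ σ B n ω) +
      proportionNoise α T₀ τ₀ σ B n ω := by
  have h1 : (0 : ℝ) < totalBalls τ₀ σ n := by exact_mod_cast totalBalls_pos hτ _
  have h2 : (totalBalls τ₀ σ (n + 1) : ℝ) = totalBalls τ₀ σ n + σ (n + 1) := by
    exact_mod_cast totalBalls_succ n
  have h3 : (0 : ℝ) ≤ σ (n + 1) := Nat.cast_nonneg _
  have h4 : (firstBin T₀ B n ω : ℝ) = totalBalls τ₀ σ n * proportion T₀ τ₀ σ B n ω := by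
    unfold proportion; field_simp
  have h5 : proportion T₀ τ₀ σ B (n + 1) ω =
      ((firstBin T₀ B n ω : ℝ) + B (n + 1) ω) / totalBalls τ₀ σ (n + 1) := by
    simp [proportion, firstBin]
  rw [h5, h4]
  unfold proportionNoise newWeight
  rw [h2]
  field_simp
  ring

namespace IsBallsAndBins

variable [IsProbabilityMeasure μ] (hB : IsBallsAndBins μ α T₀ τ₀ σ B)
include hB

/-- The conditional law gives no mass to values above `σ (n + 1)`. -/
lemma ae_cutoff_eq : ∀ᵐ ω ∂μ, ∀ n, cutoff σ B (n + 1) ω = B (n + 1) ω := by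
  have h : ∀ n k, σ (n + 1) < k → ∀ᵐ ω ∂μ, B (n + 1) ω ≠ k := by
    intro n k hk
    have hm : MeasurableSet {ω | B (n + 1) ω = k} :=
      hB.measurable (n + 1) (measurableSet_singleton k)
    have h1 : μ[({ω | B (n + 1) ω = k}).indicator (fun _ => (1 : ℝ)) | history B n] =ᵐ[μ]
        fun _ => 0 := by
      filter_upwards [hB.condLaw n k] with ω hω
      rw [hω, binomialMass, Nat.choose_eq_zero_of_lt hk]; simp
    have hle : history B n ≤ mΩ := (historyFiltration hB.measurable).le n
    have h2 : μ.real {ω | B (n + 1) ω = k} = 0 := by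
      have h3 := integral_condExp (μ := μ) (m := history B n)
        (f := ({ω | B (n + 1) ω = k}).indicator (fun _ => (1 : ℝ)))
        hle
      rw [integral_congr_ae h1, integral_zero, integral_indicator hm, setIntegral_const] at h3
      simpa using h3.symm
    have h4 : μ {ω | B (n + 1) ω = k} = 0 := (measureReal_eq_zero_iff).1 h2
    simpa [ae_iff] using h4
  have h' : ∀ᵐ ω ∂μ, ∀ n k, σ (n + 1) < k → B (n + 1) ω ≠ k := by
    rw [ae_all_iff]; intro n
    rw [ae_all_iff]; intro k
    by_cases hk : σ (n + 1) < k
    · filter_upwards [h n k hk] with ω hω _ using hω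
    · exact ae_of_all _ fun ω hk' => absurd hk' hk
  filter_upwards [h'] with ω hω n
  refine min_eq_left (not_lt.1 fun hlt => hω n _ hlt rfl)

lemma ae_proportion_cutoff_eq :
    ∀ᵐ ω ∂μ, ∀ n, proportion T₀ τ₀ σ (cutoff σ B) n ω = proportion T₀ τ₀ σ B n ω := by
  filter_upwards [hB.ae_cutoff_eq] with ω hω n
  have : firstBin T₀ (cutoff σ B) n ω = firstBin T₀ B n ω := by
    induction n with
    | zero => rfl
    | succ n ih => simp only [firstBin, ih, hω n]
  rw [proportion, proportion, this]

lemma condLaw_cutoff (n k : ℕ) :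
    μ[({ω | cutoff σ B (n + 1) ω = k}).indicator (fun _ => (1 : ℝ)) | history B n] =ᵐ[μ]
      fun ω => binomialMass (σ (n + 1))
        (feedback α (proportion T₀ τ₀ σ (cutoff σ B) n ω)) k := by
  have h1 : ({ω | cutoff σ B (n + 1) ω = k}).indicator (fun _ => (1 : ℝ)) =ᵐ[μ]
      ({ω | B (n + 1) ω = k}).indicator (fun _ => (1 : ℝ)) := by
    filter_upwards [hB.ae_cutoff_eq] with ω hω
    simp only [Set.indicator, Set.mem_ofPred_eq, hω n]
  refine (condExp_congr_ae h1).trans ((hB.condLaw n k).trans ?_)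
  filter_upwards [hB.ae_proportion_cutoff_eq] with ω hω
  rw [hω n]

/-- The conditional law of `B_{n+1}` in integrated form. -/
lemma integral_cutoff (n : ℕ) {H : ℕ → Ω → ℝ} {C : ℝ}
    (hH : ∀ k, Measurable[history B n] (H k)) (hHC : ∀ k ≤ σ (n + 1), ∀ ω, |H k ω| ≤ C) :
    ∫ ω, H (cutoff σ B (n + 1) ω) ω ∂μ =
      ∫ ω, binomialMean (σ (n + 1)) (feedback α (proportion T₀ τ₀ σ (cutoff σ B) n ω))
        (fun k => H k ω) ∂μ := by
  have hle : history B n ≤ mΩ := (historyFiltration hB.measurable).le n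
  have hcm : Measurable (cutoff σ B (n + 1)) :=
    (measurable_cutoff le_rfl).mono ((historyFiltration hB.measurable).le (n + 1)) le_rfl
  set e : ℕ → Ω → ℝ := fun k => ({ω | cutoff σ B (n + 1) ω = k}).indicator fun _ => (1 : ℝ) with he
  have hem : ∀ k, MeasurableSet {ω | cutoff σ B (n + 1) ω = k} := fun k =>
    hcm (measurableSet_singleton k)
  have hei : ∀ k, Integrable (e k) μ := fun k => (integrable_const _).indicator (hem k)
  have hHe : ∀ k ≤ σ (n + 1), Integrable (H k * e k) μ := fun k hk => by
    refine integrable_of_measurable_of_abs_le (C := C)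
      (((hH k).mono hle le_rfl).mul (measurable_const.indicator (hem k))) fun ω => ?_
    rw [Pi.mul_apply, abs_mul]
    have h0 := (abs_nonneg _).trans (hHC k hk ω)
    by_cases h : cutoff σ B (n + 1) ω = k
    · simpa [he, h] using hHC k hk ω
    · simpa [he, h] using h0
  have hpt : ∀ ω, H (cutoff σ B (n + 1) ω) ω =
      ∑ k ∈ Finset.range (σ (n + 1) + 1), (H k * e k) ω := by
    intro ω
    have hmem : cutoff σ B (n + 1) ω ∈ Finset.range (σ (n + 1) + 1) :=
      Finset.mem_range.2 (Nat.lt_succ_of_le (min_le_right _ _))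
    rw [Finset.sum_eq_single_of_mem _ hmem]
    · simp [he]
    · intro k _ hk
      simp [he, hk.symm]
  have hpull : ∀ k ≤ σ (n + 1), μ[H k * e k | history B n] =ᵐ[μ] fun ω =>
      binomialMass (σ (n + 1)) (feedback α (proportion T₀ τ₀ σ (cutoff σ B) n ω)) k * H k ω := by
    intro k hk
    refine (condExp_mul_of_stronglyMeasurable_left (hH k).stronglyMeasurable (hHe k hk)
      (hei k)).trans ?_
    filter_upwards [hB.condLaw_cutoff n k] with ω hω
    rw [Pi.mul_apply, hω, mul_comm]
  simp_rw [hpt, binomialMean]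
  rw [integral_finsetSum, integral_finsetSum]
  · refine Finset.sum_congr rfl fun k hk => ?_
    have hk' : k ≤ σ (n + 1) := Nat.lt_succ_iff.1 (Finset.mem_range.1 hk)
    rw [← integral_congr_ae (hpull k hk'), integral_condExp hle]
  · intro k hk
    exact integrable_condExp.congr (hpull k (Nat.lt_succ_iff.1 (Finset.mem_range.1 hk)))
  · intro k hk
    exact hHe k (Nat.lt_succ_iff.1 (Finset.mem_range.1 hk))

/-- Conditional moments of the noise are central moments of the binomial distribution, up to the
factor `τ_{n+1}`. -/
lemma integral_mul_noise_pow (hT : T₀ ≤ τ₀) (n j : ℕ) {c : Ω → ℝ} {C : ℝ}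
    (hc : Measurable[history B n] c) (hcC : ∀ ω, |c ω| ≤ C) :
    ∫ ω, c ω * proportionNoise α T₀ τ₀ σ (cutoff σ B) n ω ^ j ∂μ =
      ∫ ω, c ω * (binomialMean (σ (n + 1)) (feedback α (proportion T₀ τ₀ σ (cutoff σ B) n ω))
        (fun k => ((k : ℝ) - σ (n + 1) * feedback α (proportion T₀ τ₀ σ (cutoff σ B) n ω)) ^ j) /
          (totalBalls τ₀ σ (n + 1) : ℝ) ^ j) ∂μ := by
  set p : Ω → ℝ := fun ω => feedback α (proportion T₀ τ₀ σ (cutoff σ B) n ω) with hp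
  have hpm : Measurable[history B n] p := measurable_feedback.comp (measurable_proportion_cutoff n)
  have hp0 : ∀ ω, 0 ≤ p ω := fun ω =>
    feedback_nonneg (proportion_cutoff_nonneg n ω) (proportion_cutoff_le_one hT n ω)
  have hp1 : ∀ ω, p ω ≤ 1 := fun ω =>
    feedback_le_one (proportion_cutoff_nonneg n ω) (proportion_cutoff_le_one hT n ω)
  set t : ℝ := (totalBalls τ₀ σ (n + 1) : ℝ) ^ j with ht
  have h := hB.integral_cutoff n (H := fun k ω => c ω / t * ((k : ℝ) - σ (n + 1) * p ω) ^ j)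
    (C := C / t * (σ (n + 1) : ℝ) ^ j)
    (fun k => (hc.div_const t).mul ((measurable_const.sub (hpm.const_mul _)).pow_const j))
    (fun k hk ω => by
      have hk' : (k : ℝ) ≤ σ (n + 1) := by exact_mod_cast hk
      have hk0 : (0 : ℝ) ≤ k := Nat.cast_nonneg k
      have ht0 : 0 ≤ t := by positivity
      have h1 : |(k : ℝ) - σ (n + 1) * p ω| ≤ σ (n + 1) := by
        have h2 : (σ (n + 1) : ℝ) * p ω ≤ σ (n + 1) :=
          mul_le_of_le_one_right (Nat.cast_nonneg _) (hp1 ω)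
        have h3 : 0 ≤ (σ (n + 1) : ℝ) * p ω := mul_nonneg (Nat.cast_nonneg _) (hp0 ω)
        rw [abs_le]; constructor <;> linarith
      have hC : 0 ≤ C := (abs_nonneg _).trans (hcC ω)
      rw [abs_mul, abs_div, abs_of_nonneg ht0, abs_pow]
      gcongr
      exact hcC ω)
  refine Eq.trans ?_ (h.trans ?_)
  · refine integral_congr_ae (ae_of_all _ fun ω => ?_)
    simp only [proportionNoise, div_pow]
    ring
  · refine integral_congr_ae (ae_of_all _ fun ω => ?_)
    simp only [binomialMean_const_mul]
    ring

lemma setIntegral_noise_pow (hT : T₀ ≤ τ₀) (n j : ℕ) {A : Set Ω}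
    (hA : MeasurableSet[history B n] A) :
    ∫ ω in A, proportionNoise α T₀ τ₀ σ (cutoff σ B) n ω ^ j ∂μ =
      ∫ ω in A, (binomialMean (σ (n + 1)) (feedback α (proportion T₀ τ₀ σ (cutoff σ B) n ω))
        (fun k => ((k : ℝ) - σ (n + 1) * feedback α (proportion T₀ τ₀ σ (cutoff σ B) n ω)) ^ j) /
          (totalBalls τ₀ σ (n + 1) : ℝ) ^ j) ∂μ := by
  have hA0 := (historyFiltration hB.measurable).le n _ hA
  have h := hB.integral_mul_noise_pow hT n j (c := A.indicator fun _ => 1) (C := 1)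
    (Measurable.indicator measurable_const hA) fun ω => by
      by_cases hω : ω ∈ A <;> simp [hω]
  rw [← integral_indicator hA0, ← integral_indicator hA0]
  refine Eq.trans ?_ (h.trans ?_) <;>
  · refine integral_congr_ae (ae_of_all _ fun ω => ?_)
    by_cases hω : ω ∈ A <;> simp [hω]

/-- The distance of the proportion to `1 / 2` is a noisy recursion repelled by the origin. -/
lemma noisyRecursion (hα : 1 < α) (hτ : 0 < τ₀) (hT : T₀ ≤ τ₀) {L δ : ℝ} (hL1 : 1 ≤ L)
    (hL : ∀ x, 0 ≤ x → x ≤ 1 → |feedback α x - 1 / 2| ≤ L * |x - 1 / 2|)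
    (hδ : ∀ x, |x - 1 / 2| < δ → 1 / 8 ≤ feedback α x * (1 - feedback α x)) :
    NoisyRecursion μ (historyFiltration hB.measurable) (noiseScale τ₀ σ) L δ
      (fun n ω => proportion T₀ τ₀ σ (cutoff σ B) n ω - 1 / 2)
      (fun n ω => proportion T₀ τ₀ σ (cutoff σ B) n ω + newWeight τ₀ σ n *
        (feedback α (proportion T₀ τ₀ σ (cutoff σ B) n ω) -
          proportion T₀ τ₀ σ (cutoff σ B) n ω) - 1 / 2)
      (proportionNoise α T₀ τ₀ σ (cutoff σ B)) := by
  have hx0 : ∀ n ω, 0 ≤ proportion T₀ τ₀ σ (cutoff σ B) n ω := proportion_cutoff_nonneg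
  have hx1 : ∀ n ω, proportion T₀ τ₀ σ (cutoff σ B) n ω ≤ 1 := proportion_cutoff_le_one hT
  have hf0 := fun n ω => feedback_nonneg (α := α) (hx0 n ω) (hx1 n ω)
  have hf1 := fun n ω => feedback_le_one (α := α) (hx0 n ω) (hx1 n ω)
  have hg0 : ∀ n, 0 ≤ newWeight τ₀ σ n := newWeight_nonneg
  have hg1 : ∀ n, newWeight τ₀ σ n ≤ 1 := newWeight_le_one
  have hxm : ∀ n, Measurable[history B n] (proportion T₀ τ₀ σ (cutoff σ B) n) :=
    measurable_proportion_cutoff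
  have hfm := fun n => (measurable_feedback (α := α)).comp (hxm n)
  have hpq : ∀ n ω, feedback α (proportion T₀ τ₀ σ (cutoff σ B) n ω) *
      (1 - feedback α (proportion T₀ τ₀ σ (cutoff σ B) n ω)) ≤ 1 := fun n ω => by
    nlinarith [hf0 n ω, hf1 n ω]
  have hpm : ∀ n, Measurable (fun ω => feedback α (proportion T₀ τ₀ σ (cutoff σ B) n ω) *
      (1 - feedback α (proportion T₀ τ₀ σ (cutoff σ B) n ω))) := fun n =>
    ((hfm n).mul (measurable_const.sub (hfm n))).mono
      ((historyFiltration hB.measurable).le n) le_rfl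
  have hvar : ∀ n A, MeasurableSet[history B n] A →
      ∫ ω in A, proportionNoise α T₀ τ₀ σ (cutoff σ B) n ω ^ 2 ∂μ =
      ∫ ω in A, noiseScale τ₀ σ n * (feedback α (proportion T₀ τ₀ σ (cutoff σ B) n ω) *
        (1 - feedback α (proportion T₀ τ₀ σ (cutoff σ B) n ω))) ∂μ := fun n A hA => by
    rw [hB.setIntegral_noise_pow hT n 2 hA]
    simp only [binomialMean_centered_sq, noiseScale]
    refine integral_congr_ae (ae_of_all _ fun ω => ?_)
    ring
  have hpi : ∀ n, Integrable (fun ω => noiseScale τ₀ σ n *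
      (feedback α (proportion T₀ τ₀ σ (cutoff σ B) n ω) *
        (1 - feedback α (proportion T₀ τ₀ σ (cutoff σ B) n ω)))) μ := fun n =>
    (integrable_of_measurable_of_abs_le (C := 1) (hpm n) fun ω => by
      rw [abs_of_nonneg (mul_nonneg (hf0 n ω) (sub_nonneg.2 (hf1 n ω)))]
      exact hpq n ω).const_mul _
  have hns : ∀ n, 0 ≤ noiseScale τ₀ σ n := fun n => by unfold noiseScale; positivity
  refine ⟨?_, ?_, ?_, ?_, ?_, ?_, ?_, ?_, ?_, ?_, ?_⟩
  · intro n ω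
    rw [proportion_succ (α := α) hτ]; ring
  · intro n
    exact (hxm n).sub_const _
  · intro n
    exact (((hxm n).add (((hfm n).sub (hxm n)).const_mul _))).sub_const _
  · intro n ω
    rw [abs_le]; constructor <;> linarith [hx0 n ω, hx1 n ω]
  · intro n ω
    have h1 := mul_nonneg (hg0 n) (hf0 n ω)
    have h2 := mul_nonneg (sub_nonneg.2 (hg1 n)) (hx0 n ω)
    have h3 := mul_nonneg (hg0 n) (sub_nonneg.2 (hf1 n ω))
    have h4 := mul_nonneg (sub_nonneg.2 (hg1 n)) (sub_nonneg.2 (hx1 n ω))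
    rw [abs_le]; constructor <;> nlinarith
  · intro n ω
    have h : 0 ≤ (proportion T₀ τ₀ σ (cutoff σ B) n ω - 1 / 2) *
        (feedback α (proportion T₀ τ₀ σ (cutoff σ B) n ω) -
          proportion T₀ τ₀ σ (cutoff σ B) n ω) := by
      rcases le_total (1 / 2) (proportion T₀ τ₀ σ (cutoff σ B) n ω) with h | h
      · exact mul_nonneg (by linarith) (sub_nonneg.2 (le_feedback hα h (hx1 n ω)))
      · exact mul_nonneg_of_nonpos_of_nonpos (by linarith)
          (sub_nonpos.2 (feedback_le hα (hx0 n ω) h))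
    have := mul_nonneg (hg0 n) h
    nlinarith
  · intro n ω
    have h1 := hL _ (hx0 n ω) (hx1 n ω)
    have h2 : proportion T₀ τ₀ σ (cutoff σ B) n ω + newWeight τ₀ σ n *
        (feedback α (proportion T₀ τ₀ σ (cutoff σ B) n ω) -
          proportion T₀ τ₀ σ (cutoff σ B) n ω) - 1 / 2 =
        (1 - newWeight τ₀ σ n) * (proportion T₀ τ₀ σ (cutoff σ B) n ω - 1 / 2) +
        newWeight τ₀ σ n * (feedback α (proportion T₀ τ₀ σ (cutoff σ B) n ω) - 1 / 2) := by ring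
    rw [h2]
    refine (abs_add_le _ _).trans ?_
    rw [abs_mul, abs_mul, abs_of_nonneg (hg0 n), abs_of_nonneg (sub_nonneg.2 (hg1 n))]
    have h3 := mul_le_mul_of_nonneg_left h1 (hg0 n)
    have h4 : |proportion T₀ τ₀ σ (cutoff σ B) n ω - 1 / 2| ≤
        L * |proportion T₀ τ₀ σ (cutoff σ B) n ω - 1 / 2| :=
      le_mul_of_one_le_left (abs_nonneg _) hL1
    have h5 := mul_le_mul_of_nonneg_left h4 (sub_nonneg.2 (hg1 n))
    linarith
  · rintro n c hc ⟨C, hC⟩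
    have h := hB.integral_mul_noise_pow hT n 1 hc hC
    simp only [pow_one, binomialMean_centered, zero_div, mul_zero, integral_zero] at h
    exact h
  · intro n A hA
    rw [hvar n A hA]
    calc _ ≤ ∫ ω in A, noiseScale τ₀ σ n ∂μ :=
          setIntegral_mono (hpi n).integrableOn (integrable_const _) fun ω =>
            mul_le_of_le_one_right (hns n) (hpq n ω)
      _ = _ := by rw [setIntegral_const, smul_eq_mul, mul_comm]
  · intro n A hA hz
    rw [hvar n A hA]
    calc _ = ∫ ω in A, noiseScale τ₀ σ n / 8 ∂μ := by
          rw [setIntegral_const, smul_eq_mul, mul_comm]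
      _ ≤ _ := by
          refine setIntegral_mono_on (integrable_const _) (hpi n).integrableOn
            ((historyFiltration hB.measurable).le n _ hA) fun ω hω => ?_
          have := mul_le_mul_of_nonneg_left (hδ _ (hz ω hω)) (hns n)
          linarith
  · intro n A hA
    rw [hB.setIntegral_noise_pow hT n 4 hA]
    have hA0 := (historyFiltration hB.measurable).le n _ hA
    have hle : ∀ ω, binomialMean (σ (n + 1)) (feedback α (proportion T₀ τ₀ σ (cutoff σ B) n ω))
        (fun k => ((k : ℝ) - σ (n + 1) * feedback α (proportion T₀ τ₀ σ (cutoff σ B) n ω)) ^ 4) /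
          (totalBalls τ₀ σ (n + 1) : ℝ) ^ 4 ≤ noiseScale τ₀ σ n ^ 2 := fun ω => by
      have : noiseScale τ₀ σ n ^ 2 = (σ (n + 1) : ℝ) ^ 2 / (totalBalls τ₀ σ (n + 1) : ℝ) ^ 4 := by
        unfold noiseScale; ring
      rw [this]
      gcongr
      exact binomialMean_centered_pow_four_le _ (hf0 n ω) (hf1 n ω)
    refine (integral_mono_of_nonneg (ae_of_all _ fun ω => ?_) (integrable_const _)
      (ae_of_all _ hle)).trans_eq ?_
    · refine div_nonneg (Finset.sum_nonneg fun k _ => mul_nonneg ?_ (Even.pow_nonneg (by decide) _))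
        (by positivity)
      exact mul_nonneg (mul_nonneg (Nat.cast_nonneg _) (pow_nonneg (hf0 n ω) _))
        (pow_nonneg (sub_nonneg.2 (hf1 n ω)) _)
    · rw [integral_const, smul_eq_mul, mul_comm]; simp

/-- Once the cut-off is undone, this combines the pathwise trichotomy with the almost sure exclusion
of the limit `1 / 2`. -/
theorem ae_mem_dominance (hα : 1 < α) (hT₀ : 0 < T₀) (hτ₀ : T₀ < τ₀)
    (hσ : ∀ n, 1 ≤ n → 0 < σ n) : ∀ᵐ ω ∂μ, ω ∈ dominance T₀ τ₀ σ B := by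
  have hτ : 0 < τ₀ := hT₀.trans hτ₀
  obtain ⟨L, hL1, hL⟩ := exists_feedback_lipschitz α
  obtain ⟨δ, hδ, hδv⟩ := exists_feedback_variance hα
  have R := hB.noisyRecursion hα hτ hτ₀.le hL1 hL hδv
  have hv := noiseScale_pos (τ₀ := τ₀) (σ := σ) hτ hσ
  have hs := summable_noiseScale (τ₀ := τ₀) (σ := σ) hτ
  have hconv := R.ae_exists_tendsto_sum_noise (fun k => (hv k).le)
    fun K => hs.sum_le_tsum _ fun i _ => (hv i).le
  have hnot := R.ae_not_tendsto_zero hv hs hδ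
  filter_upwards [hconv, hnot, hB.ae_proportion_cutoff_eq] with ω ⟨s, h1⟩ h2 h3
  have hx0 := fun n => proportion_cutoff_nonneg (T₀ := T₀) (τ₀ := τ₀) (σ := σ) (B := B) n ω
  have hx1 := fun n => proportion_cutoff_le_one (σ := σ) (B := B) hτ₀.le n ω
  have htri := tendsto_trichotomy (a := 1 / 2)
    (z := fun n => proportion T₀ τ₀ σ (cutoff σ B) n ω - 1 / 2)
    (h := fun x => feedback α (x + 1 / 2) - (x + 1 / 2))
    (fun n => by rw [abs_le]; constructor <;> linarith [hx0 n, hx1 n])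
    (fun n => by
      simp only [sub_add_cancel]
      rw [proportion_succ (α := α) hτ]; ring)
    newWeight_nonneg (not_summable_newWeight hτ hσ)
    (fun x hx => by
      have hx' := abs_le.1 hx
      have h := feedback_one_sub (α := α) (x := x + 1 / 2) (by linarith [hx'.1])
        (by linarith [hx'.2])
      have e : 1 - (x + 1 / 2) = -x + 1 / 2 := by ring
      rw [e] at h
      rw [h]; ring)
    (fun x h0 h1 => sub_nonneg.2 (le_feedback hα (by linarith) (by linarith)))
    (fun x h0 h1 => sub_pos.2 (lt_feedback hα (by linarith) (by linarith)))
    (fun x h0 h1 => by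
      have hx : ContinuousAt (fun y : ℝ => y + 1 / 2) x :=
        continuousAt_id.add continuousAt_const
      exact (ContinuousAt.comp (g := feedback α)
        (continuousAt_feedback hα (by linarith) (by linarith)) hx).sub hx)
    h1
  simp only [dominance, Set.mem_ofPred_eq, ← h3]
  rcases htri with h | h | h
  · refine ⟨1, by simp, ?_⟩
    have := h.add_const (1 / 2)
    norm_num at this
    exact this
  · refine ⟨0, by simp, ?_⟩
    have := h.add_const (1 / 2)
    norm_num at this
    exact this
  · exact absurd h h2

end IsBallsAndBins

end ProportionProcess

end BallsBins

theorem theorem2 {Ω : Type*} [MeasurableSpace Ω] (μ : Measure Ω) [IsProbabilityMeasure μ]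
    (α : ℝ) (hα : 1 < α)
    (T₀ τ₀ : ℕ) (hT₀ : 0 < T₀) (hτ₀ : T₀ < τ₀)
    (σ : ℕ → ℕ) (hσ : ∀ n, 1 ≤ n → 0 < σ n)
    (hS : BddAbove (Set.range fun n => σ (n + 1)) ∨ Tendsto σ atTop atTop)
    (hR : BddAbove (Set.range (BallsBins.growthRatio τ₀ σ)) ∨
      Tendsto (BallsBins.growthRatio τ₀ σ) atTop atTop)
    (B : ℕ → Ω → ℕ) (hB : BallsBins.IsBallsAndBins μ α T₀ τ₀ σ B) :
    μ (BallsBins.dominance T₀ τ₀ σ B) = 1 := by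
  have h : BallsBins.dominance T₀ τ₀ σ B =ᵐ[μ] Set.univ :=
    eventuallyEq_univ.2 (hB.ae_mem_dominance hα hT₀ hτ₀ hσ)
  rw [measure_congr h, measure_univ]
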